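/- Let $\Gamma$ be a free abelian group of finite rank $k\le 2$, and let $G$ be a finite $\Gamma$-labeled graph without isolated vertices: a finite directed multigraph with vertex set $V$ and edge set $E$ and a label $\psi(e)\in\Gamma$ on every edge, where reversing an edge inverts its label. $G$ is assumed loopless and semi-simple, i.e. no two distinct edges are parallel with the same label (up to simultaneously reversing the direction and inverting the label). The label of a closed walk is the signed sum of the labels of its edges. The rank of a subgraph $H$ is the rank of the subgroup of $\Gamma$ generated by the labels of the closed walks in $H$. An edge set is balanced if every closed walk in it has trivial label, and $G$ is unbalanced if $E$ is not balanced. A $(0,2)$-block of $G$ is a subgraph $H$ of rank $0$ such that the set $B(H)$ of vertices of $H$ incident to an edge of $E\setminus E(H)$ has exactly two elements and $V(H)\setminus B(H)\neq\emptyset$. $G$ is 2-connected if it has at least two vertices, is connected and has no cut vertex. For a homomorphism $L:\Gamma\to\mathbb{R}^2$ and $p:V\to\mathbb{R}^2$, $(G,\psi,p)$ is $L$-periodically rigid if for all $q$ in some neighborhood of $p$ in $(\mathbb{R}^2)^V$ the following holds: if $\|p(u)-(p(v)+L(\psi(e)))\|=\|q(u)-(q(v)+L(\psi(e)))\|$ for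 every edge $e$ from $u$ to $v$, then $\|p(u)-(p(v)+L(\gamma))\|=\|q(u)-(q(v)+L(\gamma))\|$ for all $u,v\in V$ and $\gamma\in\Gamma$. The homomorphism $L$ is nonsingular if $L(\Gamma)$ spans a space of dimension $k$, and $p$ is generic (for $L$) if its $2|V|$ coordinates are algebraically independent over the field generated over $\mathbb{Q}$ by the coordinates of the values of $L$. $G$ is periodically rigid if $(G,\psi,p)$ is $L$-periodically rigid for some generic $p$ and some nonsingular $L$ [respectively: for any generic $p$ and any nonsingular $L$], and redundantly periodically rigid if $G-e$ is periodically rigid for every $e\in E$. For $F\subseteq E$ let $V(F)$ be the set of vertices incident to $F$. Call $I\subseteq E$ independent if $|F|\le 2|V(F)|-2$ for every nonempty $F\subseteq I$ and $|F|\le 2|V(F)|-3$ for every nonempty balanced $F\subseteq I$. These are the independent sets of a matroid on $E$, the restriction to $E$ of the periodic count matroid $\mathcal{R}_2(V,\Gamma)$. $G$ is M-connected if this matroid has at least two elements and any two distinct elements lie in a common circuit. Theorem. Suppose that $G$ is unbalanced and has no $(0,2)$-block. Then $G$ is 2-connected and redundantly periodically rigid if and only if $G$ is M-connected. This holds with either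 of the two forms (some / any) of periodic rigidity. -/

import Mathlib

open Filter Topology

/-- A `Γ`-labeled graph on the vertex set `V` with edge set `E`: a directed multigraph with a label
in `Γ` on every edge. `Γ` is written additively. It is loopless, and semi-simple: no two distinct
edges are identical, where a label `γ` in one direction is the label `-γ` in the other. -/
structure LabeledGraph (V E Γ : Type*) [AddCommGroup Γ] where
  src : E → V
  tgt : E → V
  label : E → Γ
  loopless : ∀ e, src e ≠ tgt e
  semisimple : ∀ e f, e ≠ f →
    ¬ (src e = src f ∧ tgt e = tgt f ∧ label e = label f) ∧
    ¬ (src e = tgt f ∧ tgt e = src f ∧ label e = -label f)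

namespace LabeledGraph

variable {V E Γ : Type*} [AddCommGroup Γ]

/-- `G.HasWalk F u w g`: there is a walk from `u` to `w` using only edges of `F`, traversed in
either direction, whose total signed label is `g`. -/
inductive HasWalk (G : LabeledGraph V E Γ) (F : Set E) : V → V → Γ → Prop
  | nil (v : V) : HasWalk G F v v 0
  | forward {e : E} (he : e ∈ F) {w : V} {g : Γ} (h : HasWalk G F (G.tgt e) w g) :
      HasWalk G F (G.src e) w (G.label e + g)
  | backward {e : E} (he : e ∈ F) {w : V} {g : Γ} (h : HasWalk G F (G.src e) w g) :
      HasWalk G F (G.tgt e) w (-G.label e + g)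

/-- The subgroup of `Γ` generated by the labels of all closed walks in `F`. -/
def gainGroup (G : LabeledGraph V E Γ) (F : Set E) : AddSubgroup Γ :=
  AddSubgroup.closure {g | ∃ v, G.HasWalk F v v g}

/-- The rank of an edge set (or of a subgraph with this edge set). -/
noncomputable def rank (G : LabeledGraph V E Γ) (F : Set E) : ℕ :=
  Module.finrank ℤ (G.gainGroup F)

/-- An edge set is balanced if every closed walk in it has trivial label. -/
def Balanced (G : LabeledGraph V E Γ) (F : Set E) : Prop :=
  ∀ v g, G.HasWalk F v v g → g = 0

/-- `V(F)`, the set of vertices incident to `F`. -/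
def vertexSet (G : LabeledGraph V E Γ) (F : Set E) : Set V :=
  {v | ∃ e ∈ F, G.src e = v ∨ G.tgt e = v}

/-- The underlying simple graph; it has the same connectivity properties. -/
def toSimpleGraph (G : LabeledGraph V E Γ) : SimpleGraph V where
  Adj u v := ∃ e, (G.src e = u ∧ G.tgt e = v) ∨ (G.src e = v ∧ G.tgt e = u)
  symm := ⟨fun _ _ ⟨e, h⟩ => ⟨e, h.symm⟩⟩
  loopless := ⟨fun _ ⟨e, h⟩ => G.loopless e (by rcases h with ⟨a, b⟩ | ⟨a, b⟩ <;> exact a.trans b.symm)⟩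

/-- 2-connected: at least two vertices, connected, and no cut vertex. (Two vertices joined by
parallel edges form a 2-connected multigraph.) -/
def TwoConnected (G : LabeledGraph V E Γ) : Prop :=
  Nontrivial V ∧ G.toSimpleGraph.Connected ∧
    ∀ v, (G.toSimpleGraph.induce {v}ᶜ).Connected

/-- The `Γ`-labeled graph `G - e`. -/
def deleteEdge (G : LabeledGraph V E Γ) (e : E) : LabeledGraph V {f : E // f ≠ e} Γ where
  src f := G.src f
  tgt f := G.tgt f
  label f := G.label f
  loopless f := G.loopless f
  semisimple f f' h := G.semisimple f f' (fun h' => h (Subtype.ext h'))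

/-! ### Blocks -/

/-- A subgraph of `G`. -/
structure Subgraph (G : LabeledGraph V E Γ) where
  verts : Set V
  edges : Set E
  src_mem : ∀ e ∈ edges, G.src e ∈ verts
  tgt_mem : ∀ e ∈ edges, G.tgt e ∈ verts

/-- `B(H)`: the vertices of `H` incident to some edge of `G` outside `H`. -/
def Subgraph.boundary {G : LabeledGraph V E Γ} (H : G.Subgraph) : Set V :=
  H.verts ∩ G.vertexSet H.edgesᶜ

/-- `I(H) = V(H) \ B(H)`. -/
def Subgraph.inner {G : LabeledGraph V E Γ} (H : G.Subgraph) : Set V :=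
  H.verts \ H.boundary

/-- `H` is an `(s,t)`-block. -/
def Subgraph.IsBlock {G : LabeledGraph V E Γ} (H : G.Subgraph) (s t : ℕ) : Prop :=
  G.rank H.edges = s ∧ H.boundary.ncard = t ∧ H.inner.Nonempty

/-! ### Periodic rigidity -/

/-- A homomorphism `L : Γ → ℝ^d` is nonsingular if its image has the rank of `Γ`. -/
def Nonsingular {d : ℕ} (L : Γ →+ EuclideanSpace ℝ (Fin d)) : Prop :=
  Module.finrank ℝ (Submodule.span ℝ (Set.range L)) = Module.finrank ℤ Γ

/-- The coordinates of `p` are algebraically independent over the field generated by the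
coordinates of the values of `L` (this field is `ℚ` if `L` is rational-valued). -/
def Generic {d : ℕ} (L : Γ →+ EuclideanSpace ℝ (Fin d)) (p : V → EuclideanSpace ℝ (Fin d)) :
    Prop :=
  AlgebraicIndependent (IntermediateField.adjoin ℚ {x : ℝ | ∃ γ i, x = L γ i})
    (fun vi : V × Fin d => p vi.1 vi.2)

/-- The framework `(G, ψ, p)` is `L`-periodically rigid: for all `q` near `p`, if the lengths of all
edges of `G` agree in `p` and `q` then so do the lengths of all edges of the complete `Γ`-labeled
graph on `V`. -/
def LPeriodicallyRigid {d : ℕ} (G : LabeledGraph V E Γ) (L : Γ →+ EuclideanSpace ℝ (Fin d))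
    (p : V → EuclideanSpace ℝ (Fin d)) : Prop :=
  ∀ᶠ q in 𝓝 p,
    (∀ e, ‖p (G.src e) - (p (G.tgt e) + L (G.label e))‖ ^ 2 =
      ‖q (G.src e) - (q (G.tgt e) + L (G.label e))‖ ^ 2) →
    ∀ u v γ, ‖p u - (p v + L γ)‖ ^ 2 = ‖q u - (q v + L γ)‖ ^ 2

/-- Periodic rigidity in `ℝ^d`, in the form "for some generic `p` and some nonsingular `L`". -/
def PeriodicallyRigid (G : LabeledGraph V E Γ) (d : ℕ) : Prop :=
  ∃ (L : Γ →+ EuclideanSpace ℝ (Fin d)) (p : V → EuclideanSpace ℝ (Fin d)),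
    Nonsingular L ∧ Generic L p ∧ G.LPeriodicallyRigid L p

/-- Periodic rigidity in `ℝ^d`, in the form "for any generic `p` and any nonsingular `L`". -/
def PeriodicallyRigidAny (G : LabeledGraph V E Γ) (d : ℕ) : Prop :=
  ∀ (L : Γ →+ EuclideanSpace ℝ (Fin d)) (p : V → EuclideanSpace ℝ (Fin d)),
    Nonsingular L → Generic L p → G.LPeriodicallyRigid L p

/-- Redundant periodic rigidity in `ℝ^d` ("some" form): `G - e` is periodically rigid for
every edge `e`. -/
def RedundantlyPeriodicallyRigid (G : LabeledGraph V E Γ) (d : ℕ) : Prop :=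
  ∀ e, (G.deleteEdge e).PeriodicallyRigid d

/-- Redundant periodic rigidity in `ℝ^d` ("any" form). -/
def RedundantlyPeriodicallyRigidAny (G : LabeledGraph V E Γ) (d : ℕ) : Prop :=
  ∀ e, (G.deleteEdge e).PeriodicallyRigidAny d

/-! ### The count matroid -/

/-- Independence in the count matroid: `|F| ≤ 2|V(F)| - 2` for every nonempty `F ⊆ I`, and
`|F| ≤ 2|V(F)| - 3` for every nonempty balanced `F ⊆ I`. -/
def CountIndep (G : LabeledGraph V E Γ) (I : Set E) : Prop :=
  ∀ F ⊆ I, F.Nonempty →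
    F.ncard + 2 ≤ 2 * (G.vertexSet F).ncard ∧
    (G.Balanced F → F.ncard + 3 ≤ 2 * (G.vertexSet F).ncard)

/-- `φ` is a potential for the labels on `F`. -/
def IsPotential (G : LabeledGraph V E Γ) (F : Set E) (φ : V → Γ) : Prop :=
  ∀ e ∈ F, G.label e = φ (G.src e) - φ (G.tgt e)

theorem HasWalk.trans {G : LabeledGraph V E Γ} {F : Set E} {u v w : V} {g h : Γ}
    (h₁ : G.HasWalk F u v g) (h₂ : G.HasWalk F v w h) : G.HasWalk F u w (g + h) := by
  induction h₁ with
  | nil => simpa using h₂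
  | forward he _ ih => rw [add_assoc]; exact .forward he (ih h₂)
  | backward he _ ih => rw [add_assoc]; exact .backward he (ih h₂)

theorem HasWalk.symm {G : LabeledGraph V E Γ} {F : Set E} {u v : V} {g : Γ}
    (h₁ : G.HasWalk F u v g) : G.HasWalk F v u (-g) := by
  induction h₁ with
  | nil => simpa using HasWalk.nil _
  | @forward e he w g _ ih =>
    have := ih.trans (.backward he (.nil _))
    rwa [add_zero, ← neg_add_rev] at this
  | @backward e he w g _ ih =>
    have := ih.trans (.forward he (.nil _))
    rwa [add_zero, ← neg_neg (G.label e), ← neg_add_rev] at this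

theorem balanced_iff_potential (G : LabeledGraph V E Γ) (F : Set E) :
    G.Balanced F ↔ ∃ φ, G.IsPotential F φ := by
  constructor
  · intro hF
    let s : Setoid V :=
      { r := fun u v => ∃ g, G.HasWalk F u v g
        iseqv :=
          { refl := fun v => ⟨0, .nil v⟩
            symm := fun ⟨g, h⟩ => ⟨-g, h.symm⟩
            trans := fun ⟨g, h⟩ ⟨g', h'⟩ => ⟨g + g', h.trans h'⟩ } }
    have hrep : ∀ v, ∃ g, G.HasWalk F v (Quotient.mk s v).out g := fun v =>
      s.iseqv.symm (Quotient.mk_out (s := s) v)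
    choose φ hφ using hrep
    refine ⟨φ, fun e he => ?_⟩
    have hq : Quotient.mk s (G.src e) = Quotient.mk s (G.tgt e) :=
      Quotient.sound ⟨_, .forward he (.nil _)⟩
    have h1 := hφ (G.src e)
    rw [hq] at h1
    have h2 := HasWalk.forward he (hφ (G.tgt e))
    have h3 := hF _ _ (h2.trans h1.symm)
    rw [← sub_eq_zero, ← h3]
    abel
  · rintro ⟨φ, hφ⟩ v g h
    have key : ∀ u w g, G.HasWalk F u w g → g = φ u - φ w := by
      intro u w g h
      induction h with
      | nil => simp
      | forward he _ ih => rw [hφ _ he, ih]; abel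
      | backward he _ ih => rw [hφ _ he, ih]; abel
    simpa using key _ _ _ h

theorem IsPotential.mono {G : LabeledGraph V E Γ} {F F' : Set E} {φ : V → Γ}
    (h : G.IsPotential F φ) (hF : F' ⊆ F) : G.IsPotential F' φ := fun e he => h e (hF he)

theorem Balanced.mono {G : LabeledGraph V E Γ} {F F' : Set E}
    (h : G.Balanced F) (hF : F' ⊆ F) : G.Balanced F' := by
  rw [balanced_iff_potential] at *
  obtain ⟨φ, hφ⟩ := h
  exact ⟨φ, hφ.mono hF⟩

theorem vertexSet_mono (G : LabeledGraph V E Γ) {F F' : Set E} (h : F' ⊆ F) :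
    G.vertexSet F' ⊆ G.vertexSet F := fun _ ⟨e, he, h'⟩ => ⟨e, h he, h'⟩

theorem vertexSet_union (G : LabeledGraph V E Γ) (F F' : Set E) :
    G.vertexSet (F ∪ F') = G.vertexSet F ∪ G.vertexSet F' := by
  ext v; simp only [vertexSet, Set.mem_ofPred_eq, Set.mem_union]; aesop

theorem src_mem_vertexSet (G : LabeledGraph V E Γ) {F : Set E} {e : E} (h : e ∈ F) :
    G.src e ∈ G.vertexSet F := ⟨e, h, .inl rfl⟩

theorem tgt_mem_vertexSet (G : LabeledGraph V E Γ) {F : Set E} {e : E} (h : e ∈ F) :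
    G.tgt e ∈ G.vertexSet F := ⟨e, h, .inr rfl⟩

theorem countIndep_mono {G : LabeledGraph V E Γ} {I J : Set E} (hJ : G.CountIndep J)
    (h : I ⊆ J) : G.CountIndep I := fun F hF => hJ F (hF.trans h)

theorem balanced_union {G : LabeledGraph V E Γ} {A B : Set E} {φ φ' : V → Γ}
    (h : G.IsPotential A φ) (h' : G.IsPotential B φ') {c : Γ}
    (hc : ∀ v ∈ G.vertexSet A ∩ G.vertexSet B, φ v - φ' v = c) : G.Balanced (A ∪ B) := by
  classical
  rw [balanced_iff_potential]
  have hval : ∀ v ∈ G.vertexSet B,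
      (if v ∈ G.vertexSet A then φ v else φ' v + c) = φ' v + c := by
    intro v hv
    split_ifs with hA
    · rw [← hc v ⟨hA, hv⟩]; abel
    · rfl
  refine ⟨fun v => if v ∈ G.vertexSet A then φ v else φ' v + c, ?_⟩
  rintro e (he | he)
  · simp only [G.src_mem_vertexSet he, G.tgt_mem_vertexSet he, if_true]
    exact h e he
  · simp only
    rw [hval _ (G.src_mem_vertexSet he), hval _ (G.tgt_mem_vertexSet he), h' e he]
    abel

variable [Finite V] [Finite E]

/-- Two potentials of a dense enough independent balanced set differ by a constant. -/
theorem potential_unique {G : LabeledGraph V E Γ} {I F : Set E} (hI : G.CountIndep I)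
    (hFI : F ⊆ I) (hF : F.Nonempty) {φ φ' : V → Γ} (h : G.IsPotential F φ)
    (h' : G.IsPotential F φ') {W : Set V} (hW : G.vertexSet F ⊆ W)
    (hc : 2 * W.ncard < F.ncard + 5) : ∃ c, ∀ v ∈ W, φ v - φ' v = c := by
  by_contra! hcon
  obtain ⟨e₀, he₀⟩ := hF
  set c := φ (G.src e₀) - φ' (G.src e₀) with hcdef
  have hdiff : ∀ e ∈ F, φ (G.src e) - φ' (G.src e) = φ (G.tgt e) - φ' (G.tgt e) := by
    intro e he
    have h1 := h e he
    rw [h' e he] at h1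
    rw [sub_eq_sub_iff_add_eq_add] at h1 ⊢
    rw [← h1, add_comm]
  let X : Set V := {v | v ∈ W ∧ φ v - φ' v = c}
  let Y : Set V := {v | v ∈ W ∧ φ v - φ' v ≠ c}
  have hXY : X.ncard + Y.ncard = W.ncard := by
    rw [← Set.ncard_union_eq]
    · congr 1; ext v; simp only [X, Y, Set.mem_union, Set.mem_ofPred_eq]; tauto
    · rw [Set.disjoint_left]; rintro v ⟨_, h1⟩ ⟨_, h2⟩; exact h2 h1
  let A : Set E := {e | e ∈ F ∧ φ (G.src e) - φ' (G.src e) = c}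
  let B : Set E := {e | e ∈ F ∧ φ (G.src e) - φ' (G.src e) ≠ c}
  have hAB : A.ncard + B.ncard = F.ncard := by
    rw [← Set.ncard_union_eq]
    · congr 1; ext v; simp only [A, B, Set.mem_union, Set.mem_ofPred_eq]; tauto
    · rw [Set.disjoint_left]; rintro v ⟨_, h1⟩ ⟨_, h2⟩; exact h2 h1
  have hAF : A ⊆ F := fun e he => he.1
  have hBF : B ⊆ F := fun e he => he.1
  have hbal : ∀ S ⊆ F, G.Balanced S := fun S hS =>
    (G.balanced_iff_potential S).2 ⟨φ, h.mono hS⟩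
  have hAX : (G.vertexSet A).ncard ≤ X.ncard := by
    refine Set.ncard_le_ncard ?_ (Set.toFinite _)
    rintro v ⟨e, he, rfl | rfl⟩
    · exact ⟨hW (G.src_mem_vertexSet he.1), he.2⟩
    · exact ⟨hW (G.tgt_mem_vertexSet he.1), (hdiff e he.1) ▸ he.2⟩
  have hBY : (G.vertexSet B).ncard ≤ Y.ncard := by
    refine Set.ncard_le_ncard ?_ (Set.toFinite _)
    rintro v ⟨e, he, rfl | rfl⟩
    · exact ⟨hW (G.src_mem_vertexSet he.1), he.2⟩
    · exact ⟨hW (G.tgt_mem_vertexSet he.1), (hdiff e he.1) ▸ he.2⟩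
  have h1 := (hI A (hAF.trans hFI) ⟨e₀, he₀, rfl⟩).2 (hbal A hAF)
  have hY : 0 < Y.ncard := by
    obtain ⟨v, hv, hne⟩ := hcon c
    exact (Set.ncard_pos (Set.toFinite _)).2 ⟨v, hv, hne⟩
  rcases B.eq_empty_or_nonempty with hB | hB
  · rw [hB, Set.ncard_empty] at hAB
    omega
  · have h2 := (hI B (hBF.trans hFI) hB).2 (hbal B hBF)
    omega

/-- A nonempty edge set attaining its count. -/
def Tight (G : LabeledGraph V E Γ) (T : Set E) : Prop :=
  T.Nonempty ∧ (G.Balanced T → 2 * (G.vertexSet T).ncard = T.ncard + 3) ∧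
    (¬ G.Balanced T → 2 * (G.vertexSet T).ncard = T.ncard + 2)

/-- The ends of `e` lie in `V(T)`, and `e` does not change whether `T` is balanced. -/
def Spans (G : LabeledGraph V E Γ) (T : Set E) (e : E) : Prop :=
  G.src e ∈ G.vertexSet T ∧ G.tgt e ∈ G.vertexSet T ∧
    (G.Balanced T → G.Balanced (insert e T))

theorem Tight.union {G : LabeledGraph V E Γ} {I A B : Set E} (hI : G.CountIndep I)
    (hAI : A ⊆ I) (hBI : B ⊆ I) (hA : G.Tight A) (hB : G.Tight B) (hAB : (A ∩ B).Nonempty) :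
    G.Tight (A ∪ B) := by
  have hne : (A ∪ B).Nonempty := hA.1.inl
  have hU := hI (A ∪ B) (Set.union_subset hAI hBI) hne
  have hN := hI (A ∩ B) (Set.inter_subset_left.trans hAI) hAB
  have hE := Set.ncard_union_add_ncard_inter A B
  have hV := Set.ncard_union_add_ncard_inter (G.vertexSet A) (G.vertexSet B)
  rw [← G.vertexSet_union] at hV
  have hsub : G.vertexSet (A ∩ B) ⊆ G.vertexSet A ∩ G.vertexSet B :=
    Set.subset_inter (G.vertexSet_mono Set.inter_subset_left)
      (G.vertexSet_mono Set.inter_subset_right)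
  have hle := Set.ncard_le_ncard hsub (Set.toFinite _)
  refine ⟨hne, fun hb => ?_, fun hb => ?_⟩
  · have hbA := hb.mono (Set.subset_union_left (s := A) (t := B))
    have hbB := hb.mono (Set.subset_union_right (s := A) (t := B))
    have h1 := hA.2.1 hbA
    have h2 := hB.2.1 hbB
    have h3 := hN.2 (hbA.mono Set.inter_subset_left)
    have h4 := hU.2 hb
    omega
  · have h4 := hU.1
    by_cases hbA : G.Balanced A
    · have h1 := hA.2.1 hbA
      by_cases hbB : G.Balanced B
      · have h2 := hB.2.1 hbB
        obtain ⟨φ, hφ⟩ := (G.balanced_iff_potential A).1 hbA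
        obtain ⟨φ', hφ'⟩ := (G.balanced_iff_potential B).1 hbB
        by_cases hlt : 2 * (G.vertexSet A ∩ G.vertexSet B).ncard < (A ∩ B).ncard + 5
        · obtain ⟨c, hc⟩ := potential_unique hI (Set.inter_subset_left.trans hAI) hAB
            (hφ.mono Set.inter_subset_left) (hφ'.mono Set.inter_subset_right) hsub hlt
          exact absurd (balanced_union hφ hφ' hc) hb
        · omega
      · have h2 := hB.2.2 hbB
        have h3 := hN.2 (hbA.mono Set.inter_subset_left)
        omega
    · have h1 := hA.2.2 hbA
      by_cases hbB : G.Balanced B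
      · have h2 := hB.2.1 hbB
        have h3 := hN.2 (hbB.mono Set.inter_subset_right)
        omega
      · have h2 := hB.2.2 hbB
        have h3 := hN.1
        omega

/-- A potential of a tight balanced set extends to every spanned edge. -/
theorem Spans.label_eq {G : LabeledGraph V E Γ} {I T : Set E} {e : E} (hI : G.CountIndep I)
    (hTI : T ⊆ I) (hT : G.Tight T) {φ : V → Γ} (hφ : G.IsPotential T φ) (he : G.Spans T e) :
    G.label e = φ (G.src e) - φ (G.tgt e) := by
  have hb : G.Balanced T := (G.balanced_iff_potential T).2 ⟨φ, hφ⟩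
  obtain ⟨φ', hφ'⟩ := (G.balanced_iff_potential _).1 (he.2.2 hb)
  have h1 := hT.2.1 hb
  obtain ⟨c, hc⟩ := potential_unique hI hTI hT.1 hφ (hφ'.mono (Set.subset_insert _ _))
    (W := G.vertexSet T) subset_rfl (by omega)
  rw [hφ' e (Set.mem_insert _ _)]
  have h2 := (hc _ he.1).trans (hc _ he.2.1).symm
  rw [sub_eq_sub_iff_add_eq_add] at h2 ⊢
  rw [add_comm, ← h2, add_comm]

theorem Spans.mono {G : LabeledGraph V E Γ} {I F T : Set E} {e : E} (hI : G.CountIndep I)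
    (hTI : T ⊆ I) (hFT : F ⊆ T) (hF : G.Tight F) (he : G.Spans F e) : G.Spans T e := by
  refine ⟨G.vertexSet_mono hFT he.1, G.vertexSet_mono hFT he.2.1, fun hb => ?_⟩
  obtain ⟨φ, hφ⟩ := (G.balanced_iff_potential T).1 hb
  refine (G.balanced_iff_potential _).2 ⟨φ, ?_⟩
  rintro f (rfl | hf)
  · exact he.label_eq hI (hFT.trans hTI) hF (hφ.mono hFT)
  · exact hφ f hf

theorem exists_tight_of_not_indep {G : LabeledGraph V E Γ} {I : Set E} (hI : G.CountIndep I)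
    {e : E} (he : ¬ G.CountIndep (insert e I)) : ∃ F ⊆ I, G.Tight F ∧ G.Spans F e := by
  unfold CountIndep at he
  push Not at he
  obtain ⟨X, hX, hXne, hviol⟩ := he
  have heX : e ∈ X := by
    by_contra heX
    have := hI X (fun f hf => (hX hf).resolve_left (fun h => heX (h ▸ hf))) hXne
    obtain ⟨hb, hlt⟩ := hviol this.1
    exact absurd (this.2 hb) (by omega)
  let F := X \ {e}
  have hins : insert e F = X := by simp [F, Set.insert_eq_of_mem heX]
  have hFI : F ⊆ I := fun f hf => (hX hf.1).resolve_left hf.2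
  have hcard : X.ncard = F.ncard + 1 := (Set.ncard_sdiff_singleton_add_one heX).symm
  have hFX : F ⊆ X := Set.sdiff_subset
  have hVle := Set.ncard_le_ncard (G.vertexSet_mono hFX) (Set.toFinite _)
  have hFne : F.Nonempty := by
    by_contra hF
    rw [Set.not_nonempty_iff_eq_empty] at hF
    have h2 : ({G.src e, G.tgt e} : Set V).ncard ≤ (G.vertexSet X).ncard := by
      refine Set.ncard_le_ncard ?_ (Set.toFinite _)
      rintro v (rfl | rfl)
      · exact G.src_mem_vertexSet heX
      · exact G.tgt_mem_vertexSet heX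
    rw [Set.ncard_pair (G.loopless e)] at h2
    rw [hF, Set.ncard_empty] at hcard
    obtain ⟨_, h3⟩ := hviol (by omega)
    omega
  have hFc := hI F hFI hFne
  have hbX : G.Balanced X → G.Balanced F := fun h => h.mono hFX
  have main : (G.vertexSet F).ncard = (G.vertexSet X).ncard ∧ G.Tight F ∧
      (G.Balanced F → G.Balanced X) := by
    by_cases hb : G.Balanced X
    · have h1 := hFc.2 (hbX hb)
      have h2 : 2 * (G.vertexSet X).ncard < X.ncard + 3 := by
        by_contra hlt
        have := (hviol (by omega)).2
        omega
      refine ⟨by omega, ⟨hFne, fun _ => by omega, fun h => absurd (hbX hb) h⟩, fun _ => hb⟩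
    · have h2 : 2 * (G.vertexSet X).ncard < X.ncard + 2 := by
        by_contra hlt
        exact hb (hviol (by omega)).1
      by_cases hbF : G.Balanced F
      · have h1 := hFc.2 hbF
        omega
      · have h1 := hFc.1
        exact ⟨by omega, ⟨hFne, fun h => absurd h hbF, fun _ => by omega⟩, fun h => absurd h hbF⟩
  obtain ⟨hVeq, hT, hbal⟩ := main
  have hV : G.vertexSet F = G.vertexSet X :=
    Set.eq_of_subset_of_ncard_le (G.vertexSet_mono hFX) hVeq.ge (Set.toFinite _)
  refine ⟨F, hFI, hT, ?_, ?_, ?_⟩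
  · rw [hV]; exact G.src_mem_vertexSet heX
  · rw [hV]; exact G.tgt_mem_vertexSet heX
  · rw [hins]; exact hbal

/-- An independent set contained in the span of a tight set `T` has at most `|T|` elements. -/
theorem ncard_le_of_spans {G : LabeledGraph V E Γ} {I T K : Set E} (hI : G.CountIndep I)
    (hTI : T ⊆ I) (hT : G.Tight T) (hK : G.CountIndep K) (hs : ∀ e ∈ K, G.Spans T e) :
    K.ncard ≤ T.ncard := by
  rcases K.eq_empty_or_nonempty with rfl | hKne
  · simp
  have hV : (G.vertexSet K).ncard ≤ (G.vertexSet T).ncard := by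
    refine Set.ncard_le_ncard ?_ (Set.toFinite _)
    rintro v ⟨e, he, rfl | rfl⟩
    · exact (hs e he).1
    · exact (hs e he).2.1
  have h1 := hK K subset_rfl hKne
  by_cases hb : G.Balanced T
  · obtain ⟨φ, hφ⟩ := (G.balanced_iff_potential T).1 hb
    have h2 := h1.2 ((G.balanced_iff_potential K).2
      ⟨φ, fun e he => (hs e he).label_eq hI hTI hT hφ⟩)
    have h3 := hT.2.1 hb
    omega
  · have h2 := h1.1
    have h3 := hT.2.2 hb
    omega

theorem countIndep_augment (G : LabeledGraph V E Γ) {I J : Set E} (hI : G.CountIndep I)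
    (hJ : G.CountIndep J) (hlt : I.ncard < J.ncard) :
    ∃ e ∈ J, e ∉ I ∧ G.CountIndep (insert e I) := by
  classical
  have := Fintype.ofFinite E
  by_contra! hcon
  let P : Set E → Prop := fun T => T ⊆ I ∧ G.Tight T
  let 𝒯 : Finset (Set E) := Finset.univ.filter (fun T => Maximal P T)
  have hmem : ∀ T, T ∈ 𝒯 ↔ Maximal P T := fun T => by simp [𝒯]
  have hext : ∀ F, P F → ∃ T ∈ 𝒯, F ⊆ T := fun F hF => by
    obtain ⟨T, hle, hT⟩ := (Set.toFinite {T | P T}).exists_le_maximal hF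
    exact ⟨T, (hmem T).2 hT, hle⟩
  have hdisj : ∀ T ∈ 𝒯, ∀ T' ∈ 𝒯, T ≠ T' → Disjoint T T' := by
    intro T hT T' hT' hne
    rw [Set.disjoint_iff_inter_eq_empty]
    by_contra hnemp
    rw [← Ne, ← Set.nonempty_iff_ne_empty] at hnemp
    rw [hmem] at hT hT'
    have hU : P (T ∪ T') := ⟨Set.union_subset hT.prop.1 hT'.prop.1,
      Tight.union hI hT.prop.1 hT'.prop.1 hT.prop.2 hT'.prop.2 hnemp⟩
    exact hne ((hT.eq_of_subset hU Set.subset_union_left).trans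
      (hT'.eq_of_subset hU Set.subset_union_right).symm)
  let R : Finset E := I.toFinset.filter (fun e => ∀ T ∈ 𝒯, e ∉ T)
  have hJsub : J.toFinset ⊆
      R ∪ 𝒯.biUnion (fun T => {e ∈ J.toFinset | G.Spans T e}) := by
    intro e he
    have heJ : e ∈ J := by simpa using he
    rw [Finset.mem_union, Finset.mem_biUnion]
    by_cases heI : e ∈ I
    · by_cases hT : ∃ T ∈ 𝒯, e ∈ T
      · obtain ⟨T, hT, heT⟩ := hT
        refine .inr ⟨T, hT, ?_⟩
        simp only [Finset.mem_filter]
        exact ⟨he, G.src_mem_vertexSet heT, G.tgt_mem_vertexSet heT,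
          fun h => by rwa [Set.insert_eq_of_mem heT]⟩
      · push Not at hT
        exact .inl (by simp only [R, Finset.mem_filter, Set.mem_toFinset]; exact ⟨heI, hT⟩)
    · obtain ⟨F, hFI, hF, hFe⟩ := exists_tight_of_not_indep hI (hcon e heJ heI)
      obtain ⟨T, hT, hFT⟩ := hext F ⟨hFI, hF⟩
      refine .inr ⟨T, hT, ?_⟩
      simp only [Finset.mem_filter]
      exact ⟨he, hFe.mono hI ((hmem T).1 hT).prop.1 hFT hF⟩
  have hJcard : J.ncard ≤ R.card + ∑ T ∈ 𝒯, T.ncard := by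
    rw [Set.ncard_eq_toFinset_card']
    refine (Finset.card_le_card hJsub).trans ((Finset.card_union_le _ _).trans ?_)
    refine Nat.add_le_add_left (Finset.card_biUnion_le.trans (Finset.sum_le_sum ?_)) _
    intro T hT
    have hp := ((hmem T).1 hT).prop
    rw [← Set.ncard_coe_finset]
    refine ncard_le_of_spans hI hp.1 hp.2 (countIndep_mono hJ ?_) ?_
    · intro e he; simp at he; exact he.1
    · intro e he; simp at he; exact he.2
  have hIcard : R.card + ∑ T ∈ 𝒯, T.ncard ≤ I.ncard := by
    have h1 : ∑ T ∈ 𝒯, T.ncard = (𝒯.biUnion (fun T => T.toFinset)).card := by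
      rw [Finset.card_biUnion]
      · exact Finset.sum_congr rfl fun T _ => Set.ncard_eq_toFinset_card' T
      · intro T hT T' hT' hne
        exact Set.disjoint_toFinset.2 (hdisj T hT T' hT' hne)
    rw [h1, ← Finset.card_union_of_disjoint, Set.ncard_eq_toFinset_card']
    · refine Finset.card_le_card ?_
      intro e he
      rw [Finset.mem_union, Finset.mem_biUnion] at he
      rcases he with he | ⟨T, hT, he⟩
      · exact (Finset.mem_filter.1 he).1
      · exact Set.mem_toFinset.2 (((hmem T).1 hT).prop.1 (Set.mem_toFinset.1 he))
    · rw [Finset.disjoint_left]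
      intro e he he'
      obtain ⟨T, hT, he'⟩ := Finset.mem_biUnion.1 he'
      exact (Finset.mem_filter.1 he).2 T hT (Set.mem_toFinset.1 he')
  omega

/-- The restriction to `E(G)` of the periodic count matroid on the complete `Γ`-labeled graph
on `V`: the matroid on `E(G)` whose independent sets are those satisfying the counts. -/
def countMatroid (G : LabeledGraph V E Γ) : Matroid E :=
  (IndepMatroid.ofFinite (Set.toFinite Set.univ) G.CountIndep
    (fun _ hF hne => absurd (Set.subset_empty_iff.1 hF) hne.ne_empty)
    (fun _ _ hJ hIJ => countIndep_mono hJ hIJ)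
    (fun _ _ hI hJ h => G.countIndep_augment hI hJ h)
    (fun _ _ => Set.subset_univ _)).matroid

/-- A matroid is connected if it has at least two elements and any two distinct elements lie in
a common circuit. -/
def MatroidConnected {α : Type*} (M : Matroid α) : Prop :=
  M.E.Nontrivial ∧ ∀ e ∈ M.E, ∀ f ∈ M.E, e = f ∨ ∃ C, M.IsCircuit C ∧ e ∈ C ∧ f ∈ C

/-- `G` is M-connected. -/
def MConnected (G : LabeledGraph V E Γ) : Prop := MatroidConnected G.countMatroid

end LabeledGraph

/-! For injective `L` and generic `p` the count matroid is the row matroid of the rigidity matrix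
(`Generic.linearIndepOn_row_iff`), so the choice of `L` and `p` does not matter. Independent rows
satisfy the counts because translations are always motions, and on a balanced set so are the
rotations of the framework unrolled by a potential. For the converse, each edge is given a plane in
`(V → Plane) × ℝ`. The counts imply that any nonempty set `S` of these planes spans dimension at
least `|S| + 1`, so by a lemma of Lovász a hyperplane in general position cuts them in independent
lines. The hyperplane encodes a framework, and the lines are its rows turned by a right angle.
Rigidity is linearized in both directions. If only translations are infinitesimal motions, a
quadratic estimate gives local rigidity. At a generic framework the rank of the rows is locally
constant, so every infinitesimal motion integrates to a motion preserving edge lengths. Rigidity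
then makes it a translation, provided `L` is nonzero. Suppose `G` is M-connected. Circuits are rigid
by dimension count, and rigid sets sharing an edge have a rigid union. Hence `G`, being unbalanced,
has only translations as motions. Deleting an edge changes nothing, since its row depends on the
rest of a circuit. A circuit with edges on both sides of an edge partition forces the two sides to
share at least two vertices, which gives 2-connectivity. Conversely, redundant rigidity puts every
edge in a circuit, so every component `D` of the matroid is rigid. A base contains at least `2|V(D)|
- 2` edges of `D`, or `2|V(D)| - 3` if `D` is balanced. Let `Y` be the set of vertices of `D` shared
with other edges. By 2-connectivity `|Y| ≥ 2` when there are several components, and the absence of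
a (0,2)-block gives `|Y| ≥ 3` when `D` is balanced. Thus `D` contributes at least `2|V(D)| - |Y|`
edges to the base. Every vertex is counted at least twice in the sum, so the base has at least
`2|V|` edges, against the bound `2|V| - 2`. -/

/-! ### Transitivity of the common-circuit relation -/

/-- Two strong eliminations replace `C₂` by a circuit `C₄` that contains `g` and still meets `C₁`,
while `C₁ ∪ C₄` loses a point `x` of `C₂`. Induction on the size of the union then applies. -/
theorem Matroid.IsCircuit.exists_mem_mem_of_inter_nonempty {α : Type*} [Finite α] {M : Matroid α}
    {C₁ C₂ : Set α} {e g : α} (h₁ : M.IsCircuit C₁) (h₂ : M.IsCircuit C₂) (he : e ∈ C₁)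
    (hg : g ∈ C₂) (hne : (C₁ ∩ C₂).Nonempty) : ∃ C, M.IsCircuit C ∧ e ∈ C ∧ g ∈ C := by
  induction hn : (C₁ ∪ C₂).ncard using Nat.strong_induction_on generalizing C₂ with
  | _ n ih =>
    by_cases heC : e ∈ C₂
    · exact ⟨C₂, h₂, heC, hg⟩
    by_cases hgC : g ∈ C₁
    · exact ⟨C₁, h₁, he, hgC⟩
    obtain ⟨f, hf₁, hf₂⟩ := hne
    obtain ⟨C₃, hC₃, h₃, heC₃⟩ := h₁.strong_elimination h₂ hf₁ hf₂ he heC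
    by_cases hgC₃ : g ∈ C₃
    · exact ⟨C₃, h₃, heC₃, hgC₃⟩
    obtain ⟨x, hx₃, hx₁⟩ : ∃ x ∈ C₃, x ∉ C₁ := by
      by_contra! hcon
      have := h₃.eq_of_subset_isCircuit h₁ hcon
      exact (hC₃ (this ▸ hf₁)).2 rfl
    have hx₂ : x ∈ C₂ := (hC₃ hx₃).1.resolve_left hx₁
    obtain ⟨C₄, hC₄, h₄, hgC₄⟩ := h₂.strong_elimination h₃ hx₂ hx₃ hg hgC₃
    obtain ⟨y, hy₄, hy₂⟩ : ∃ y ∈ C₄, y ∉ C₂ := by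
      by_contra! hcon
      have := h₄.eq_of_subset_isCircuit h₂ hcon
      exact (hC₄ (this ▸ hx₂)).2 rfl
    have hy₃ : y ∈ C₃ := (hC₄ hy₄).1.resolve_left hy₂
    have hy₁ : y ∈ C₁ := (hC₃ hy₃).1.resolve_right hy₂
    have hss : C₁ ∪ C₄ ⊂ C₁ ∪ C₂ := by
      refine (Set.ssubset_iff_of_subset ?_).2 ⟨x, .inr hx₂, ?_⟩
      · rintro z (hz | hz)
        · exact .inl hz
        · rcases (hC₄ hz).1 with h | h
          · exact .inr h
          · exact (hC₃ h).1
      · rintro (h | h)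
        · exact hx₁ h
        · exact (hC₄ h).2 rfl
    exact ih _ (hn ▸ Set.ncard_lt_ncard hss (Set.toFinite _)) h₄ hgC₄ ⟨y, hy₁, hy₄⟩ rfl

/-! ### General position of a hyperplane with respect to planes (Lovász) -/

section Lovasz

variable {U : Type*} [AddCommGroup U] [Module ℝ U]

/-- Linear independence of a finite family persists under small perturbations. -/
theorem LinearIndependent.eventually_add_smul {ι : Type*} [Finite ι] {v : ι → U}
    (hv : LinearIndependent ℝ v) (w : ι → U) :
    ∀ᶠ ε in 𝓝 (0 : ℝ), LinearIndependent ℝ (fun i => v i + ε • w i) := by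
  classical
  have := Fintype.ofFinite ι
  obtain ⟨T, hT⟩ := LinearMap.exists_leftInverse_of_injective
    (Fintype.linearCombination ℝ v) (LinearMap.ker_eq_bot.2 hv.fintypeLinearCombination_injective)
  have hTv : ∀ i, T (v i) = Pi.single i 1 := fun i => by
    have := LinearMap.congr_fun hT (Pi.single i 1)
    simpa [Fintype.linearCombination_apply_single] using this
  -- Coordinates through a left inverse `T` make the family square: the determinant is continuous in
  -- `ε` and equals 1 at `ε = 0`.
  let N : ℝ → Matrix ι ι ℝ := fun ε => Matrix.of fun i => T (v i + ε • w i)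
  have hN : Continuous fun ε => (N ε).det := by
    refine Continuous.matrix_det (continuous_matrix fun i j => ?_)
    simp only [N, Matrix.of_apply, map_add, map_smul, Pi.add_apply, Pi.smul_apply]
    fun_prop
  have h0 : (N 0).det ≠ 0 := by
    have : N 0 = 1 := by
      ext i j
      simp [N, hTv, Matrix.one_apply, Pi.single_apply, eq_comm]
    simp [this]
  filter_upwards [hN.continuousAt.eventually_ne h0] with ε hε
  have h1 : LinearIndependent ℝ (fun i => T (v i + ε • w i)) :=
    Matrix.linearIndependent_rows_of_det_ne_zero hε
  exact LinearIndependent.of_comp T h1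

/-- The vector of `span {a, b} ∩ ker h`. -/
def kernelVec (h : Module.Dual ℝ U) (a b : U) : U := h b • a - h a • b

theorem kernelVec_add_smul (h g : Module.Dual ℝ U) (ε : ℝ) (a b : U) :
    kernelVec (h + ε • g) a b = kernelVec h a b + ε • kernelVec g a b := by
  simp only [kernelVec, LinearMap.add_apply, LinearMap.smul_apply, smul_eq_mul]
  module

theorem apply_kernelVec (h : Module.Dual ℝ U) (a b : U) : h (kernelVec h a b) = 0 := by
  simp [kernelVec, mul_comm]

/-- Independence of the vectors `kernelVec h (a i) (b i)` can be combined with `h y ≠ 0`. -/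
theorem exists_kernelVec_linearIndependent_ne_zero {ι : Type*} [Finite ι] {a b : ι → U}
    {h : Module.Dual ℝ U} (hh : LinearIndependent ℝ fun i => kernelVec h (a i) (b i)) {y : U}
    (hy : y ≠ 0) : ∃ g : Module.Dual ℝ U,
      (LinearIndependent ℝ fun i => kernelVec g (a i) (b i)) ∧ g y ≠ 0 := by
  by_cases h0 : h y = 0
  · obtain ⟨g, hg⟩ : ∃ g : Module.Dual ℝ U, g y ≠ 0 := by
      by_contra! hcon
      exact hy ((Module.forall_dual_apply_eq_zero_iff ℝ y).1 hcon)
    have h1 := hh.eventually_add_smul fun i => kernelVec g (a i) (b i)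
    -- The perturbed functional `h + ε • g` takes the value `ε * g y` at `y`, so `ε` must be small
    -- but nonzero.
    obtain ⟨ε, hε, hne⟩ := ((h1.filter_mono nhdsWithin_le_nhds).and
      (self_mem_nhdsWithin (a := (0 : ℝ)) (s := {0}ᶜ))).exists
    refine ⟨h + ε • g, by simpa only [kernelVec_add_smul] using hε, ?_⟩
    simpa [h0] using ⟨hne, hg⟩
  · exact ⟨h, hh, h0⟩

end Lovasz

universe u w

/-- A hyperplane in general position meets the planes `span {a i, b i}` in linearly independent
lines as soon as any nonempty set `S` of these planes spans a space of dimension at least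
`|S| + 1`. -/
theorem exists_kernelVec_linearIndependent {ι : Type w} (s : Finset ι) :
    ∀ {U : Type u} [AddCommGroup U] [Module ℝ U] [FiniteDimensional ℝ U] (a b : ι → U),
    (∀ S ⊆ s, S.Nonempty → S.card + 1 ≤ Module.finrank ℝ (Submodule.span ℝ (a '' S ∪ b '' S))) →
    ∃ h : Module.Dual ℝ U, LinearIndependent ℝ fun i : s => kernelVec h (a i) (b i) := by
  classical
  induction s using Finset.induction_on with
  | empty =>
    intro U _ _ _ a b _
    exact ⟨0, linearIndependent_empty_type⟩
  | insert j s hj ih =>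
    intro U _ _ _ a b hab
    let A : Finset ι → Submodule ℝ U := fun S => Submodule.span ℝ (a '' S ∪ b '' S)
    let P : Submodule ℝ U := Submodule.span ℝ {a j, b j}
    -- a vector of `P` outside every `A S` that does not contain `P`
    have hPA : ∀ S : Finset ι, P ≤ A S → A (insert j S) = A S := by
      intro S hS
      refine le_antisymm (Submodule.span_le.2 ?_) (Submodule.span_mono ?_)
      · have h1 : a j ∈ A S := hS (Submodule.subset_span (by simp))
        have h2 : b j ∈ A S := hS (Submodule.subset_span (by simp))
        rintro z (⟨i, hi, rfl⟩ | ⟨i, hi, rfl⟩)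
        · rcases Finset.mem_insert.1 hi with rfl | hi
          · exact h1
          · exact Submodule.subset_span (.inl ⟨i, hi, rfl⟩)
        · rcases Finset.mem_insert.1 hi with rfl | hi
          · exact h2
          · exact Submodule.subset_span (.inr ⟨i, hi, rfl⟩)
      · refine Set.union_subset_union ?_ ?_ <;>
        · refine Set.image_mono ?_
          simp
    have hP2 : 2 ≤ Module.finrank ℝ P := by
      have := hab {j} (by simp) (by simp)
      rw [Finset.coe_singleton, Set.image_singleton, Set.image_singleton,
        Set.singleton_union] at this
      exact this
    obtain ⟨x, hxP, hx0, hxA⟩ : ∃ x ∈ P, x ≠ 0 ∧ ∀ S ⊆ s, x ∈ A S → P ≤ A S := by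
      -- A real vector space is not a finite union of proper subspaces. Including `⊥` in the family
      -- also makes the chosen vector nonzero.
      let Q : Set (Submodule ℝ P) :=
        insert ⊥ ((fun S => (A S).comap P.subtype) '' {S | S ⊆ s ∧ ¬ P ≤ A S})
      have hfin : Q.Finite := by
        refine Set.Finite.insert _ (Set.Finite.image _ (Set.Finite.subset
          (Finset.finite_toSet s.powerset) ?_))
        rintro S ⟨hS, -⟩
        simpa using hS
      have hne := Subspace.biUnion_ne_univ_of_top_notMem (k := ℝ) (s := hfin.toFinset) (by
        simp only [Set.Finite.mem_toFinset, Q, Set.mem_insert_iff, Set.mem_image, not_or]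
        refine ⟨fun h => ?_, ?_⟩
        · have : Module.finrank ℝ P = 0 := by
            rw [← finrank_top, h, finrank_bot]
          omega
        · rintro ⟨S, ⟨-, hS⟩, h⟩
          exact hS (by rwa [Submodule.comap_subtype_eq_top] at h))
      rw [Set.ne_univ_iff_exists_notMem] at hne
      obtain ⟨x, hx⟩ := hne
      simp only [Set.mem_iUnion, not_exists, Set.Finite.mem_toFinset] at hx
      refine ⟨x, x.2, fun h => hx ⊥ (Set.mem_insert _ _) ?_, fun S hS hxS => ?_⟩
      · simpa using h
      · by_contra hcon
        exact hx _ (Set.mem_insert_of_mem _ ⟨S, ⟨hS, hcon⟩, rfl⟩) hxS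
    let X : Submodule ℝ U := Submodule.span ℝ {x}
    have hX1 : Module.finrank ℝ X = 1 := finrank_span_singleton hx0
    obtain ⟨h', hh'⟩ := ih (U := U ⧸ X) (fun i => X.mkQ (a i)) (fun i => X.mkQ (b i)) (by
      intro S hS hne
      have hmap : Submodule.span ℝ ((fun i => X.mkQ (a i)) '' S ∪ (fun i => X.mkQ (b i)) '' S) =
          (A S).map X.mkQ := by
        rw [Submodule.map_span, Set.image_union, Set.image_image, Set.image_image]
      rw [hmap]
      have hrk := LinearMap.finrank_range_add_finrank_ker (X.mkQ.domRestrict (A S))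
      rw [LinearMap.range_domRestrict, LinearMap.ker_domRestrict, Submodule.ker_mkQ] at hrk
      have hA := hab S (hS.trans (Finset.subset_insert _ _)) hne
      change _ ≤ Module.finrank ℝ (A S) at hA
      -- Passing to the quotient by `X` costs a dimension only if `A S` contains `P`. In that case
      -- adjoining `j` to `S` does not enlarge the span, so the hypothesis for `insert j S` supplies
      -- the missing dimension.
      by_cases hle : P ≤ A S
      · have h1 := hab (insert j S) (Finset.insert_subset_insert _ hS) (by simp)
        change _ ≤ Module.finrank ℝ (A (insert j S)) at h1
        rw [hPA S hle, Finset.card_insert_of_notMem (fun h => hj (hS h))] at h1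
        have h2 : Module.finrank ℝ (X.comap (A S).subtype) ≤ 1 := by
          rw [← hX1]
          exact LinearMap.finrank_le_finrank_of_injective
            (f := (A S).subtype.restrict (p := X.comap (A S).subtype) (q := X) fun _ h => h)
            (fun y z hyz => by
              have : (y : A S).1 = (z : A S).1 := congrArg (fun t : X => (t : U)) hyz
              exact Subtype.ext (Subtype.ext this))
        omega
      · have h2 : X.comap (A S).subtype = ⊥ := by
          rw [Submodule.eq_bot_iff]
          rintro ⟨y, hyA⟩ hy
          obtain ⟨c, rfl⟩ := Submodule.mem_span_singleton.1 (show y ∈ X from hy)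
          by_cases hc : c = 0
          · simp [hc]
          · exact absurd (hxA S hS (by simpa [hc] using (A S).smul_mem c⁻¹ hyA)) hle
        rw [h2, finrank_bot] at hrk
        omega)
    -- The functional on the quotient must not vanish on the image of `P`; otherwise its kernel
    -- would contain all of `P` and the vector attached to `j` would be zero.
    obtain ⟨y, hyP, hyX⟩ : ∃ y, (y = a j ∨ y = b j) ∧ y ∉ X := by
      by_contra! hcon
      have hle : P ≤ X := by
        refine Submodule.span_le.2 ?_
        rintro z (rfl | rfl)
        · exact hcon _ (.inl rfl)
        · exact hcon _ (.inr rfl)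
      have := Submodule.finrank_mono hle
      omega
    obtain ⟨g, hg, hgy⟩ := exists_kernelVec_linearIndependent_ne_zero hh' (y := X.mkQ y) (by
      simpa [Submodule.Quotient.mk_eq_zero] using hyX)
    let h : Module.Dual ℝ U := g ∘ₗ X.mkQ
    have h0 : X.mkQ x = 0 :=
      (Submodule.Quotient.mk_eq_zero X).2 (Submodule.mem_span_singleton_self x)
    have hhx : h x = 0 := by
      simp only [h, LinearMap.comp_apply, h0, map_zero]
    -- The pullback `h` kills `x` but not `P`, so the line it cuts from `P` is spanned by `x`.
    obtain ⟨c, hc⟩ : ∃ c : ℝ, x = c • kernelVec h (a j) (b j) := by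
      obtain ⟨α, β, rfl⟩ := Submodule.mem_span_pair.1 hxP
      simp only [map_add, map_smul, smul_eq_mul] at hhx
      have hy' : h y ≠ 0 := hgy
      rcases hyP with rfl | rfl
      · refine ⟨-β / h (a j), ?_⟩
        have : α = -β / h (a j) * h (b j) := by field_simp; linarith
        rw [kernelVec, smul_sub, smul_smul, smul_smul, ← this, sub_eq_add_neg, ← neg_smul]
        congr 2
        field_simp
      · refine ⟨α / h (b j), ?_⟩
        have : β = -(α / h (b j) * h (a j)) := by field_simp; linarith
        rw [kernelVec, smul_sub, smul_smul, smul_smul, sub_eq_add_neg, ← neg_smul, ← this]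
        congr 2
        field_simp
    have hcomp : ∀ i, X.mkQ (kernelVec h (a i) (b i)) =
        kernelVec g (X.mkQ (a i)) (X.mkQ (b i)) := fun i => by
      simp [kernelVec, h]
    refine ⟨h, ?_⟩
    have hs : LinearIndependent ℝ fun i : s => kernelVec h (a i) (b i) := by
      refine LinearIndependent.of_comp X.mkQ ?_
      simpa only [Function.comp_def, hcomp] using hg
    -- The vectors for `s` are independent modulo `x`. A relation expressing `x` through them has
    -- zero coefficients in the quotient and would force `x = 0`.
    have key : LinearIndepOn ℝ (fun i => kernelVec h (a i) (b i)) (insert j (s : Set ι)) := by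
      rw [linearIndepOn_insert (by simpa using hj)]
      refine ⟨hs, fun hmem => ?_⟩
      have hx : x ∈ Submodule.span ℝ (Set.range fun i : s => kernelVec h (a i) (b i)) := by
        rw [hc]
        refine Submodule.smul_mem _ _ ?_
        convert! hmem using 2
        ext z; simp
      obtain ⟨d, hd⟩ := (Submodule.mem_span_range_iff_exists_fun ℝ).1 hx
      rw [← hd, map_sum] at h0
      simp only [map_smul, hcomp] at h0
      have := Fintype.linearIndependent_iff.1 hg d h0
      exact hx0 (by rw [← hd]; simp [this])
    rw [← Finset.coe_insert] at key
    exact key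

abbrev Plane := EuclideanSpace ℝ (Fin 2)

namespace LabeledGraph

variable {V E Γ : Type*} [AddCommGroup Γ]

/-! ### The rigidity matrix -/

/-- The vector along the edge `e` in the framework `(G, L, p)`. -/
def edgeVec (G : LabeledGraph V E Γ) (L : Γ →+ Plane) (p : V → Plane) (e : E) : Plane :=
  p (G.src e) - (p (G.tgt e) + L (G.label e))

/-- The row of the rigidity matrix of `(G, L, p)` at the edge `e`, as a linear functional. -/
noncomputable def row (G : LabeledGraph V E Γ) (L : Γ →+ Plane) (p : V → Plane) (e : E) :
    Module.Dual ℝ (V → Plane) :=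
  innerₗ Plane (G.edgeVec L p e) ∘ₗ
    ((LinearMap.proj (G.src e) : (V → Plane) →ₗ[ℝ] Plane) - LinearMap.proj (G.tgt e))

theorem row_apply (G : LabeledGraph V E Γ) (L : Γ →+ Plane) (p : V → Plane) (e : E)
    (m : V → Plane) :
    G.row L p e m = inner ℝ (G.edgeVec L p e) (m (G.src e) - m (G.tgt e)) := rfl

theorem inner_plane (x y : Plane) : inner ℝ x y = x 0 * y 0 + x 1 * y 1 := by
  simp [PiLp.inner_apply, Fin.sum_univ_two, mul_comm]

theorem row_apply_coord (G : LabeledGraph V E Γ) (L : Γ →+ Plane) (p : V → Plane) (e : E)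
    (m : V → Plane) :
    G.row L p e m = G.edgeVec L p e 0 * (m (G.src e) 0 - m (G.tgt e) 0) +
      G.edgeVec L p e 1 * (m (G.src e) 1 - m (G.tgt e) 1) := by
  rw [row_apply, inner_plane]; rfl

/-- The infinitesimal motions of the subframework on the edge set `F`. -/
def motions (G : LabeledGraph V E Γ) (L : Γ →+ Plane) (p : V → Plane) (F : Set E) :
    Submodule ℝ (V → Plane) where
  carrier := {m | ∀ e ∈ F, G.row L p e m = 0}
  add_mem' h h' e he := by rw [map_add, h e he, h' e he, add_zero]
  zero_mem' e _ := map_zero _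
  smul_mem' c m h e he := by rw [map_smul, h e he, smul_zero]

theorem mem_motions {G : LabeledGraph V E Γ} {L : Γ →+ Plane} {p : V → Plane} {F : Set E}
    {m : V → Plane} : m ∈ G.motions L p F ↔ ∀ e ∈ F, G.row L p e m = 0 := Iff.rfl

theorem motions_anti {G : LabeledGraph V E Γ} {L : Γ →+ Plane} {p : V → Plane} {F F' : Set E}
    (h : F ⊆ F') : G.motions L p F' ≤ G.motions L p F := fun _ hm e he => hm e (h he)

theorem finrank_framework [Finite V] : Module.finrank ℝ (V → Plane) = 2 * Nat.card V := by
  have := Fintype.ofFinite V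
  rw [Module.finrank_pi_fintype]
  simp [mul_comm]

theorem motions_eq_dualCoannihilator (G : LabeledGraph V E Γ) (L : Γ →+ Plane) (p : V → Plane)
    (F : Set E) :
    G.motions L p F = (Submodule.span ℝ (G.row L p '' F)).dualCoannihilator := by
  ext m
  rw [Submodule.mem_dualCoannihilator, mem_motions]
  refine ⟨fun h φ hφ => ?_, fun h e he => h _ (Submodule.subset_span ⟨e, he, rfl⟩)⟩
  induction hφ using Submodule.span_induction with
  | mem x hx => obtain ⟨e, he, rfl⟩ := hx; exact h e he
  | zero => rfl
  | add x y _ _ hx hy => simp [hx, hy]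
  | smul c x _ hx => simp [hx]

/-- Rank–nullity: each independent row lowers the dimension of the motion space by one. -/
theorem ncard_add_finrank_motions [Finite V] [Finite E] {G : LabeledGraph V E Γ}
    {L : Γ →+ Plane} {p : V → Plane} {F : Set E} (hF : LinearIndepOn ℝ (G.row L p) F) :
    F.ncard + Module.finrank ℝ (G.motions L p F) = 2 * Nat.card V := by
  have := Fintype.ofFinite F
  have h1 := finrank_span_eq_card hF
  rw [← finrank_framework, ← Subspace.finrank_add_finrank_dualCoannihilator_eq
    (Submodule.span ℝ (G.row L p '' F)), motions_eq_dualCoannihilator]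
  congr 1
  rw [Set.image_eq_range, h1, Set.ncard_eq_toFinset_card', Set.toFinset_card]

/-- In finite dimension a subspace of the dual equals its double annihilator. -/
theorem row_mem_span_of_motions_le [Finite V] {G : LabeledGraph V E Γ} {L : Γ →+ Plane}
    {p : V → Plane} {F : Set E} {e : E} (h : ∀ m ∈ G.motions L p F, G.row L p e m = 0) :
    G.row L p e ∈ Submodule.span ℝ (G.row L p '' F) := by
  rw [← Subspace.dualCoannihilator_dualAnnihilator_eq (W := Submodule.span ℝ (G.row L p '' F)),
    ← motions_eq_dualCoannihilator, Submodule.mem_dualAnnihilator]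
  exact h

theorem row_eq_zero_of_mem_span {G : LabeledGraph V E Γ} {L : Γ →+ Plane}
    {p : V → Plane} {F : Set E} {e : E} (h : G.row L p e ∈ Submodule.span ℝ (G.row L p '' F))
    {m : V → Plane} (hm : m ∈ G.motions L p F) : G.row L p e m = 0 := by
  rw [motions_eq_dualCoannihilator, Submodule.mem_dualCoannihilator] at hm
  exact hm _ h

/-! ### Generic frameworks -/

/-- A polynomial that does not vanish at some framework does not vanish at a generic one. -/
theorem Generic.aeval_ne_zero {L : Γ →+ Plane} {p : V → Plane} (hp : Generic L p)
    (P : MvPolynomial (V × Fin 2) (IntermediateField.adjoin ℚ {x : ℝ | ∃ γ i, x = L γ i}))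
    (q : V → Plane) (hq : MvPolynomial.aeval (fun vi : V × Fin 2 => q vi.1 vi.2) P ≠ 0) :
    MvPolynomial.aeval (fun vi : V × Fin 2 => p vi.1 vi.2) P ≠ 0 := by
  intro h
  refine hq ?_
  have : P = 0 := hp (by simpa using h)
  rw [this, map_zero]

/-- The first coordinates suffice: their difference minus `L γ 0` is a polynomial over the base
field that takes the value 1 at the framework supplied. -/
theorem Generic.sub_ne {L : Γ →+ Plane} {p : V → Plane} (hp : Generic L p) {u v : V}
    (huv : u ≠ v) (γ : Γ) : p u - p v ≠ L γ := by
  classical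
  let c : IntermediateField.adjoin ℚ {x : ℝ | ∃ γ i, x = L γ i} :=
    ⟨L γ 0, IntermediateField.subset_adjoin _ _ ⟨γ, 0, rfl⟩⟩
  have := hp.aeval_ne_zero (.X (u, 0) - .X (v, 0) - .C c)
    (Pi.single u (EuclideanSpace.single 0 (L γ 0 + 1))) (by
      simp [Pi.single_apply, huv.symm, c, IntermediateField.algebraMap_apply])
  intro h
  apply this
  simp [c, ← h, IntermediateField.algebraMap_apply]

theorem Generic.edgeVec_ne_zero {G : LabeledGraph V E Γ} {L : Γ →+ Plane} {p : V → Plane}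
    (hp : Generic L p) (e : E) : G.edgeVec L p e ≠ 0 := by
  intro h
  refine hp.sub_ne (G.loopless e) (G.label e) ?_
  rw [edgeVec, ← sub_sub, sub_eq_zero] at h
  exact h

/-- Some coordinate of `L γ` is nonzero, so the cross product is a nonzero polynomial in the
positions. It makes `p u - p v` and `L γ` a basis of the plane, so a vector orthogonal to both
vanishes. -/
theorem Generic.cross_ne_zero {L : Γ →+ Plane} {p : V → Plane} (hp : Generic L p) {u v : V}
    (huv : u ≠ v) {γ : Γ} (hγ : L γ ≠ 0) :
    (p u 0 - p v 0) * L γ 1 - (p u 1 - p v 1) * L γ 0 ≠ 0 := by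
  classical
  let c : Fin 2 → IntermediateField.adjoin ℚ {x : ℝ | ∃ γ i, x = L γ i} := fun i =>
    ⟨L γ i, IntermediateField.subset_adjoin _ _ ⟨γ, i, rfl⟩⟩
  have hγ' : L γ 0 ≠ 0 ∨ L γ 1 ≠ 0 := by
    by_contra! hcon
    apply hγ
    ext i
    fin_cases i
    · exact hcon.1
    · exact hcon.2
  have key := fun q h => hp.aeval_ne_zero
    ((.X (u, 0) - .X (v, 0)) * .C (c 1) - (.X (u, 1) - .X (v, 1)) * .C (c 0)) q h
  simp only [map_sub, map_mul, MvPolynomial.aeval_X, MvPolynomial.algHom_C,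
    IntermediateField.algebraMap_apply, c] at key
  rcases hγ' with h | h
  · exact key (Pi.single u (EuclideanSpace.single 1 1)) (by simp [huv.symm, h])
  · exact key (Pi.single u (EuclideanSpace.single 0 1)) (by simp [huv.symm, h])

/-! ### Independence of rows as nonvanishing of a Gram determinant -/

section Gram

/-- The matrix of coordinates of the rows at the edges in `F`. -/
noncomputable def coordMatrix (G : LabeledGraph V E Γ) (L : Γ →+ Plane) (p : V → Plane)
    (F : Set E) [DecidableEq V] : Matrix F (V × Fin 2) ℝ :=
  Matrix.of fun e vi => G.edgeVec L p e vi.2 *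
    ((if vi.1 = G.src e then 1 else 0) - (if vi.1 = G.tgt e then 1 else 0))

theorem row_single [DecidableEq V] (G : LabeledGraph V E Γ) (L : Γ →+ Plane) (p : V → Plane)
    (F : Set E) (e : F) (v : V) (i : Fin 2) :
    G.row L p e (Pi.single v (EuclideanSpace.single i 1)) = G.coordMatrix L p F e (v, i) := by
  rw [row_apply_coord, coordMatrix, Matrix.of_apply]
  have h : G.src e ≠ G.tgt e := G.loopless e
  fin_cases i <;>
  · by_cases h1 : v = G.src e
    · subst h1; simp [h, h.symm]
    · by_cases h2 : v = G.tgt e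
      · subst h2; simp [h, h.symm]
      · simp [h1, h2, Ne.symm h1, Ne.symm h2]

theorem linearIndepOn_row_iff_coordMatrix [Finite V] [DecidableEq V] (G : LabeledGraph V E Γ)
    (L : Γ →+ Plane) (p : V → Plane) (F : Set E) :
    LinearIndepOn ℝ (G.row L p) F ↔ LinearIndependent ℝ (G.coordMatrix L p F).row := by
  have := Fintype.ofFinite V
  let T : Module.Dual ℝ (V → Plane) →ₗ[ℝ] (V × Fin 2 → ℝ) :=
    LinearMap.pi fun vi => LinearMap.applyₗ (Pi.single vi.1 (EuclideanSpace.single vi.2 (1 : ℝ)))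
  have hT : LinearMap.ker T = ⊥ := by
    rw [LinearMap.ker_eq_bot']
    intro φ hφ
    refine LinearMap.pi_ext' fun v => ?_
    refine (EuclideanSpace.basisFun (Fin 2) ℝ).toBasis.ext fun i => ?_
    simpa [T] using congrFun hφ (v, i)
  have hrow : (G.coordMatrix L p F).row = T ∘ fun e : F => G.row L p e := by
    ext e ⟨v, i⟩
    exact (G.row_single L p F e v i).symm
  rw [hrow, LinearMap.linearIndependent_iff T hT]
  rfl

/-- Over the reals `c A Aᵀ = 0` gives `|c A|² = 0`. The Gram determinant is a single polynomial in
the entries, so no choice of a nonzero minor is needed. -/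
theorem _root_.Matrix.linearIndependent_row_iff_det_mul_transpose {m n : Type*} [Fintype m]
    [DecidableEq m] [Fintype n] (A : Matrix m n ℝ) :
    LinearIndependent ℝ A.row ↔ (A * A.transpose).det ≠ 0 := by
  constructor
  · intro hA h
    obtain ⟨c, hc, hc0⟩ := Matrix.exists_vecMul_eq_zero_iff.2 h
    refine hc ?_
    have h1 : Matrix.vecMul c A ⬝ᵥ Matrix.vecMul c A = 0 := by
      have : Matrix.vecMul c (A * A.transpose) ⬝ᵥ c = 0 := by rw [hc0, zero_dotProduct]
      rwa [← Matrix.vecMul_vecMul, Matrix.vecMul_transpose, dotProduct_comm,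
        Matrix.dotProduct_mulVec] at this
    rw [dotProduct_self_eq_zero] at h1
    exact (Matrix.vecMul_injective_iff.2 hA) (by simpa using h1)
  · intro h
    have h1 := Matrix.linearIndependent_rows_of_det_ne_zero h
    refine LinearIndependent.of_comp (Matrix.mulVecLin A) ?_
    convert! h1 using 1
    ext i j
    simp [Matrix.mul_apply, Matrix.mulVec, dotProduct, mul_comm]

theorem linearIndepOn_row_iff_det [Fintype V] [DecidableEq V] (G : LabeledGraph V E Γ)
    (L : Γ →+ Plane) (p : V → Plane) (F : Set E) [Fintype F] [DecidableEq F] :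
    LinearIndepOn ℝ (G.row L p) F ↔
      (G.coordMatrix L p F * (G.coordMatrix L p F).transpose).det ≠ 0 := by
  rw [linearIndepOn_row_iff_coordMatrix, Matrix.linearIndependent_row_iff_det_mul_transpose]

/-- Rows that are independent at some framework are independent at every generic one. -/
theorem Generic.linearIndepOn_row [Finite V] [Finite E] {G : LabeledGraph V E Γ}
    {L : Γ →+ Plane} {p : V → Plane} (hp : Generic L p) {q : V → Plane} {F : Set E}
    (hq : LinearIndepOn ℝ (G.row L q) F) : LinearIndepOn ℝ (G.row L p) F := by
  classical
  have := Fintype.ofFinite V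
  have := Fintype.ofFinite F
  let K := IntermediateField.adjoin ℚ {x : ℝ | ∃ γ i, x = L γ i}
  -- The coordinate matrix with indeterminate positions; its Gram determinant has coefficients in
  -- the field over which `p` is algebraically independent.
  let R : Matrix F (V × Fin 2) (MvPolynomial (V × Fin 2) K) := Matrix.of fun e vi =>
    (.X (G.src e, vi.2) - (.X (G.tgt e, vi.2) +
      .C ⟨L (G.label e) vi.2, IntermediateField.subset_adjoin _ _ ⟨_, _, rfl⟩⟩)) *
    ((if vi.1 = G.src e then 1 else 0) - (if vi.1 = G.tgt e then 1 else 0))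
  have hR : ∀ x : V → Plane,
      MvPolynomial.aeval (fun vi : V × Fin 2 => x vi.1 vi.2) (R * R.transpose).det =
        (G.coordMatrix L x F * (G.coordMatrix L x F).transpose).det := by
    intro x
    have h1 : R.map (MvPolynomial.aeval (fun vi : V × Fin 2 => x vi.1 vi.2)) =
        G.coordMatrix L x F := by
      ext e ⟨v, i⟩
      simp [R, coordMatrix, edgeVec, apply_ite (MvPolynomial.aeval _),
        IntermediateField.algebraMap_apply]
    rw [AlgHom.map_det, AlgHom.mapMatrix_apply, Matrix.map_mul, Matrix.transpose_map, h1]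
  rw [linearIndepOn_row_iff_det] at hq ⊢
  rw [← hR] at hq ⊢
  exact hp.aeval_ne_zero _ q hq

/-- Independence of rows is an open condition. -/
theorem eventually_linearIndepOn_row [Finite V] [Finite E] {G : LabeledGraph V E Γ}
    {L : Γ →+ Plane} {p : V → Plane} {F : Set E} (hp : LinearIndepOn ℝ (G.row L p) F) :
    ∀ᶠ q in 𝓝 p, LinearIndepOn ℝ (G.row L q) F := by
  classical
  have := Fintype.ofFinite V
  have := Fintype.ofFinite F
  simp only [linearIndepOn_row_iff_det] at hp ⊢
  refine ContinuousAt.eventually_ne (Continuous.continuousAt ?_) hp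
  have : Continuous fun q => G.coordMatrix L q F := by
    refine continuous_matrix fun e vi => ?_
    simp only [coordMatrix, edgeVec, Matrix.of_apply]
    fun_prop
  fun_prop

end Gram

/-! ### Nonsingular homomorphisms -/

theorem Nonsingular.injective [Module.Free ℤ Γ] [Module.Finite ℤ Γ] {L : Γ →+ Plane}
    (hL : Nonsingular L) : Function.Injective L := by
  let b := Module.Free.chooseBasis ℤ Γ
  have hspan : Submodule.span ℝ (Set.range L) = Submodule.span ℝ (Set.range (L ∘ b)) := by
    refine le_antisymm (Submodule.span_le.2 ?_) (Submodule.span_mono ?_)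
    · rintro _ ⟨γ, rfl⟩
      rw [← b.sum_repr γ, map_sum]
      refine Submodule.sum_mem _ fun i _ => ?_
      rw [map_zsmul, ← Int.cast_smul_eq_zsmul ℝ]
      exact Submodule.smul_mem _ _ (Submodule.subset_span ⟨i, rfl⟩)
    · rintro _ ⟨i, rfl⟩
      exact ⟨b i, rfl⟩
  have hli : LinearIndependent ℝ (L ∘ b) := by
    rw [linearIndependent_iff_card_eq_finrank_span, Set.finrank, ← hspan, hL,
      Module.finrank_eq_card_basis b]
  rw [injective_iff_map_eq_zero]
  intro γ hγ
  rw [← b.sum_repr γ, map_sum] at hγ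
  simp only [map_zsmul, ← Int.cast_smul_eq_zsmul ℝ] at hγ
  have := Fintype.linearIndependent_iff.1 hli (fun i => (b.repr γ i : ℝ)) hγ
  rw [← b.sum_repr γ]
  exact Finset.sum_eq_zero fun i _ => by simp [Int.cast_eq_zero.1 (this i)]

theorem exists_nonsingular [Module.Free ℤ Γ] [Module.Finite ℤ Γ]
    (hk : Module.finrank ℤ Γ ≤ 2) : ∃ L : Γ →+ Plane, Nonsingular L := by
  let b := Module.finBasis ℤ Γ
  let c : Fin (Module.finrank ℤ Γ) → Plane :=
    fun i => EuclideanSpace.basisFun (Fin 2) ℝ (Fin.castLE hk i)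
  let L : Γ →ₗ[ℤ] Plane := b.constr ℤ c
  refine ⟨L.toAddMonoidHom, ?_⟩
  have hspan : Submodule.span ℝ (Set.range L) = Submodule.span ℝ (Set.range c) := by
    refine le_antisymm (Submodule.span_le.2 ?_) (Submodule.span_mono ?_)
    · rintro _ ⟨γ, rfl⟩
      rw [Module.Basis.constr_apply_fintype]
      refine Submodule.sum_mem _ fun i _ => ?_
      rw [← Int.cast_smul_eq_zsmul ℝ]
      exact Submodule.smul_mem _ _ (Submodule.subset_span ⟨i, rfl⟩)
    · rintro _ ⟨i, rfl⟩
      exact ⟨b i, Module.Basis.constr_basis _ _ _ _⟩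
  have hc : LinearIndependent ℝ c :=
    (EuclideanSpace.basisFun (Fin 2) ℝ).toBasis.linearIndependent.comp _
      (Fin.castLE_injective hk) |> fun h => by simpa [Function.comp_def, c] using h
  change Module.finrank ℝ (Submodule.span ℝ (Set.range L)) = _
  rw [hspan, finrank_span_eq_card hc, Fintype.card_fin]

/-- The field generated by the values of `L` is countable. A finite transcendence basis of `ℝ` over
it would make `ℝ` countable, so there is room for all the coordinates. -/
theorem exists_generic [Finite V] [Countable Γ] (L : Γ →+ Plane) :
    ∃ p : V → Plane, Generic L p := by
  let S : Set ℝ := {x : ℝ | ∃ γ i, x = L γ i}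
  have hS : S.Countable := by
    have : S = Set.range fun x : Γ × Fin 2 => L x.1 x.2 := by
      ext x; simp [S, eq_comm]
    rw [this]
    exact Set.countable_range _
  let K := IntermediateField.adjoin ℚ S
  have hK : Cardinal.mk K ≤ Cardinal.aleph0 := by
    refine (IntermediateField.cardinalMk_adjoin_le ℚ S).trans ?_
    simp [hS.le_aleph0]
  obtain ⟨s, hs⟩ := exists_isTranscendenceBasis K ℝ
  have hinf : Infinite s := by
    by_contra hcon
    rw [not_infinite_iff_finite] at hcon
    have := hs.isAlgebraic
    have h1 := Algebra.IsAlgebraic.cardinalMk_le_max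
      (Algebra.adjoin K (Set.range ((↑) : s → ℝ))) ℝ
    have h2 := Algebra.cardinalMk_adjoin_le K (Set.range ((↑) : s → ℝ))
    have h3 : Cardinal.mk (Set.range ((↑) : s → ℝ)) ≤ Cardinal.aleph0 :=
      (Set.countable_range _).le_aleph0
    have h4 : Cardinal.mk ℝ ≤ Cardinal.aleph0 :=
      h1.trans (max_le (h2.trans (max_le (max_le hK h3) le_rfl)) le_rfl)
    rw [Cardinal.mk_real] at h4
    exact absurd h4 (not_le.2 Cardinal.aleph0_lt_continuum)
  obtain ⟨n, ⟨f'⟩⟩ := Finite.exists_equiv_fin (V × Fin 2)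
  let f : V × Fin 2 ↪ s :=
    f'.toEmbedding.trans (Fin.valEmbedding.trans (Infinite.natEmbedding s))
  refine ⟨fun v => WithLp.toLp 2 fun i => f (v, i), ?_⟩
  exact hs.1.comp f f.injective

/-! ### Trivial motions -/

/-- The motions that agree on `X` with a member of the family `ψ`. -/
def agreeOn {S : Type*} [AddCommGroup S] [Module ℝ S] (ψ : S →ₗ[ℝ] V → Plane) (X : Set V) :
    Submodule ℝ (V → Plane) where
  carrier := {m | ∃ s, ∀ v ∈ X, m v = ψ s v}
  add_mem' := by
    rintro m m' ⟨s, h⟩ ⟨s', h'⟩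
    exact ⟨s + s', fun v hv => by simp [h v hv, h' v hv]⟩
  zero_mem' := ⟨0, fun v _ => by simp⟩
  smul_mem' := by
    rintro c m ⟨s, h⟩
    exact ⟨c • s, fun v hv => by simp [h v hv]⟩

/-- A member is given by its parameter in `S`, which `hψ` makes unique, together with free values
off `X`. -/
theorem finrank_agreeOn [Finite V] {S : Type*} [AddCommGroup S] [Module ℝ S]
    [FiniteDimensional ℝ S] (ψ : S →ₗ[ℝ] V → Plane) (X : Set V)
    (hψ : ∀ s, (∀ v ∈ X, ψ s v = 0) → s = 0) :
    Module.finrank ℝ (agreeOn ψ X) + 2 * X.ncard = 2 * Nat.card V + Module.finrank ℝ S := by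
  classical
  have := Fintype.ofFinite V
  let Φ : S × ({v // v ∉ X} → Plane) →ₗ[ℝ] (V → Plane) :=
    { toFun := fun sx v => if h : v ∈ X then ψ sx.1 v else sx.2 ⟨v, h⟩
      map_add' := fun a b => by ext1 v; by_cases h : v ∈ X <;> simp [h]
      map_smul' := fun c a => by ext1 v; by_cases h : v ∈ X <;> simp [h] }
  have hΦ : ∀ sx v, Φ sx v = if h : v ∈ X then ψ sx.1 v else sx.2 ⟨v, h⟩ := fun _ _ => rfl
  have hinj : Function.Injective Φ := by
    rw [← LinearMap.ker_eq_bot, LinearMap.ker_eq_bot']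
    rintro ⟨s, x⟩ h
    have hs : s = 0 := hψ s fun v hv => by simpa [hΦ, hv] using congrFun h v
    have hx : x = 0 := by
      ext1 v
      simpa [hΦ, v.2] using congrFun h v
    rw [hs, hx]; rfl
  have hrange : LinearMap.range Φ = agreeOn ψ X := by
    ext m
    constructor
    · rintro ⟨⟨s, x⟩, rfl⟩
      exact ⟨s, fun v hv => by simp [hΦ, hv]⟩
    · rintro ⟨s, hs⟩
      refine ⟨⟨s, fun v => m v⟩, ?_⟩
      ext1 v
      by_cases hv : v ∈ X <;> simp [hΦ, hv, hs]
  rw [← hrange, LinearMap.finrank_range_of_inj hinj, Module.finrank_prod, finrank_framework]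
  have h1 : Nat.card {v // v ∉ X} = Xᶜ.ncard := rfl
  have h2 := Set.ncard_add_ncard_compl X
  omega

/-- The infinitesimal translations. -/
def translation (V : Type*) : Plane →ₗ[ℝ] (V → Plane) := LinearMap.pi fun _ => LinearMap.id

@[simp] theorem translation_apply (t : Plane) (v : V) : translation V t v = t := rfl

/-- The rotation of the plane by a right angle. -/
noncomputable def quarterTurn : Plane →ₗ[ℝ] Plane where
  toFun x := !₂[-x 1, x 0]
  map_add' x y := by ext i; fin_cases i <;> simp [add_comm]
  map_smul' c x := by ext i; fin_cases i <;> simp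

theorem inner_quarterTurn_self (x : Plane) : inner ℝ x (quarterTurn x) = 0 := by
  rw [inner_plane]
  simp [quarterTurn]; ring

theorem quarterTurn_eq_zero {x : Plane} (h : quarterTurn x = 0) : x = 0 := by
  have h0 := congrArg (fun y : Plane => y 0) h
  have h1 := congrArg (fun y : Plane => y 1) h
  simp [quarterTurn] at h0 h1
  ext i
  fin_cases i
  · exact h1
  · exact h0

/-- The infinitesimal translations and rotations of the framework developed by the potential `φ`. -/
noncomputable def euclidean (L : Γ →+ Plane) (p : V → Plane) (φ : V → Γ) :
    (Plane × ℝ) →ₗ[ℝ] (V → Plane) :=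
  LinearMap.pi fun v => LinearMap.fst ℝ Plane ℝ +
    (LinearMap.snd ℝ Plane ℝ).smulRight (quarterTurn (p v - L (φ v)))

@[simp] theorem euclidean_apply (L : Γ →+ Plane) (p : V → Plane) (φ : V → Γ) (s : Plane × ℝ)
    (v : V) : euclidean L p φ s v = s.1 + s.2 • quarterTurn (p v - L (φ v)) := rfl

/-- Translating each vertex by `-L (φ v)` unrolls a balanced set into an ordinary framework. This is
why rotations preserve its edge lengths to first order. -/
theorem IsPotential.edgeVec_eq {G : LabeledGraph V E Γ} {F : Set E} {φ : V → Γ}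
    (h : G.IsPotential F φ) (L : Γ →+ Plane) (p : V → Plane) {e : E} (he : e ∈ F) :
    G.edgeVec L p e = (p (G.src e) - L (φ (G.src e))) - (p (G.tgt e) - L (φ (G.tgt e))) := by
  rw [edgeVec, h e he, map_sub]
  abel

theorem agreeOn_translation_le_motions (G : LabeledGraph V E Γ) (L : Γ →+ Plane) (p : V → Plane)
    (F : Set E) : agreeOn (translation V) (G.vertexSet F) ≤ G.motions L p F := by
  rintro m ⟨t, ht⟩ e he
  rw [row_apply, ht _ (G.src_mem_vertexSet he), ht _ (G.tgt_mem_vertexSet he)]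
  simp

theorem agreeOn_euclidean_le_motions {G : LabeledGraph V E Γ} {F : Set E} {φ : V → Γ}
    (h : G.IsPotential F φ) (L : Γ →+ Plane) (p : V → Plane) :
    agreeOn (euclidean L p φ) (G.vertexSet F) ≤ G.motions L p F := by
  rintro m ⟨s, hs⟩ e he
  rw [row_apply, hs _ (G.src_mem_vertexSet he), hs _ (G.tgt_mem_vertexSet he), euclidean_apply,
    euclidean_apply, add_sub_add_left_eq_sub, ← smul_sub, ← map_sub, ← h.edgeVec_eq L p he,
    inner_smul_right, inner_quarterTurn_self, mul_zero]

theorem finrank_agreeOn_translation [Finite V] {X : Set V} (hX : X.Nonempty) :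
    Module.finrank ℝ (agreeOn (translation V) X) + 2 * X.ncard = 2 * Nat.card V + 2 := by
  obtain ⟨v, hv⟩ := hX
  rw [finrank_agreeOn _ _ fun s h => by simpa using h v hv]
  simp

/-- By genericity two distinct vertices stay distinct after unrolling, so an infinitesimal rotation
cannot agree with a translation at both. -/
theorem finrank_agreeOn_euclidean [Finite V] {L : Γ →+ Plane} {p : V → Plane}
    (hp : Generic L p) (φ : V → Γ) {X : Set V} (hX : X.Nontrivial) :
    Module.finrank ℝ (agreeOn (euclidean L p φ) X) + 2 * X.ncard = 2 * Nat.card V + 3 := by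
  obtain ⟨u, hu, v, hv, huv⟩ := hX
  rw [finrank_agreeOn]
  · simp
  rintro ⟨t, ω⟩ h
  have h1 := h u hu
  have h2 := h v hv
  simp only [euclidean_apply] at h1 h2
  have h3 : ω • quarterTurn ((p u - L (φ u)) - (p v - L (φ v))) = 0 := by
    rw [map_sub, smul_sub, ← add_sub_add_left_eq_sub _ _ t, h1, h2, sub_zero]
  have hω : ω = 0 := by
    refine (smul_eq_zero.1 h3).resolve_right fun h => hp.sub_ne huv (φ u - φ v) ?_
    have := quarterTurn_eq_zero h
    rw [map_sub, ← sub_eq_zero, ← this]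
    abel
  subst hω
  simpa using h1

theorem vertexSet_nontrivial (G : LabeledGraph V E Γ) {F : Set E} (hF : F.Nonempty) :
    (G.vertexSet F).Nontrivial := by
  obtain ⟨e, he⟩ := hF
  exact ⟨_, G.src_mem_vertexSet he, _, G.tgt_mem_vertexSet he, G.loopless e⟩

/-- Independent rows of a generic framework satisfy the counts. -/
theorem Generic.countIndep_of_linearIndepOn_row [Finite V] [Finite E] {G : LabeledGraph V E Γ}
    {L : Γ →+ Plane} {p : V → Plane} (hp : Generic L p) {F : Set E}
    (hF : LinearIndepOn ℝ (G.row L p) F) : G.CountIndep F := by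
  intro F' hF' hne
  have h1 := ncard_add_finrank_motions (hF.mono hF')
  have hV := G.vertexSet_nontrivial hne
  constructor
  · have h2 := Submodule.finrank_mono (G.agreeOn_translation_le_motions L p F')
    have h3 := finrank_agreeOn_translation hV.nonempty
    omega
  · intro hb
    obtain ⟨φ, hφ⟩ := (G.balanced_iff_potential F').1 hb
    have h2 := Submodule.finrank_mono (agreeOn_euclidean_le_motions hφ L p)
    have h3 := finrank_agreeOn_euclidean hp φ hV
    omega

/-! ### The counts suffice for independence -/

/-- The setoid on the vertices given by the connected components of `F`. -/
def walkSetoid (G : LabeledGraph V E Γ) (F : Set E) : Setoid V where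
  r u v := ∃ g, G.HasWalk F u v g
  iseqv :=
    { refl := fun v => ⟨0, .nil v⟩
      symm := fun ⟨g, h⟩ => ⟨-g, h.symm⟩
      trans := fun ⟨g, h⟩ ⟨g', h'⟩ => ⟨g + g', h.trans h'⟩ }

/-- The counts summed over the connected components of `S`. -/
theorem CountIndep.ncard_add_components_le [Finite V] [Finite E] {G : LabeledGraph V E Γ}
    {S : Set E} (hS : G.CountIndep S) (hne : S.Nonempty) :
    S.ncard + 2 * Nat.card (Quotient (G.walkSetoid S)) ≤ 2 * Nat.card V ∧
    (G.Balanced S → S.ncard + 2 * Nat.card (Quotient (G.walkSetoid S)) + 1 ≤ 2 * Nat.card V) := by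
  classical
  have := Fintype.ofFinite V
  have := Fintype.ofFinite E
  let Q := Quotient (G.walkSetoid S)
  have := Fintype.ofFinite Q
  let mk : V → Q := Quotient.mk _
  have hmk : ∀ e ∈ S, mk (G.src e) = mk (G.tgt e) := fun e he =>
    Quotient.sound ⟨_, HasWalk.forward he (.nil _)⟩
  let Sx : Q → Finset E := fun x => {e ∈ S.toFinset | mk (G.src e) = x}
  let Vx : Q → Finset V := fun x => {v | mk v = x}
  have hSsum : S.ncard = ∑ x, (Sx x).card := by
    rw [Set.ncard_eq_toFinset_card']
    exact Finset.card_eq_sum_card_fiberwise fun e _ => Finset.mem_univ _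
  have hVsum : Nat.card V = ∑ x, (Vx x).card := by
    rw [Nat.card_eq_fintype_card, ← Finset.card_univ]
    exact Finset.card_eq_sum_card_fiberwise fun e _ => Finset.mem_univ _
  have hsub : ∀ x, (Sx x : Set E) ⊆ S := fun x e he => by
    have := (Finset.mem_filter.1 he).1
    simpa using this
  have hVS : ∀ x, (G.vertexSet (Sx x)).ncard ≤ (Vx x).card := by
    intro x
    rw [← Set.ncard_coe_finset]
    refine Set.ncard_le_ncard ?_ (Set.toFinite _)
    rintro v ⟨e, he, rfl | rfl⟩
    · have := (Finset.mem_filter.1 he).2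
      simpa [Vx] using this
    · have := (Finset.mem_filter.1 he).2
      rw [hmk e (hsub x he)] at this
      simpa [Vx] using this
  have hcount : ∀ x, (Sx x).Nonempty → (Sx x).card + 2 ≤ 2 * (Vx x).card ∧
      (G.Balanced S → (Sx x).card + 3 ≤ 2 * (Vx x).card) := by
    intro x hx
    have h1 := hS _ (hsub x) (by simpa using hx)
    rw [Set.ncard_coe_finset] at h1
    have h2 := hVS x
    refine ⟨by omega, fun hb => ?_⟩
    have := h1.2 (hb.mono (hsub x))
    omega
  -- A component without edges has a vertex, so the bound also holds there.
  have hall : ∀ x, (Sx x).card + 2 ≤ 2 * (Vx x).card := by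
    intro x
    rcases (Sx x).eq_empty_or_nonempty with h | h
    · have : 0 < (Vx x).card := by
        obtain ⟨v, rfl⟩ := Quotient.exists_rep x
        exact Finset.card_pos.2 ⟨v, by simp [Vx, mk]⟩
      rw [h, Finset.card_empty]
      omega
    · exact (hcount x h).1
  have hlhs : S.ncard + 2 * Nat.card Q = ∑ x, ((Sx x).card + 2) := by
    rw [Finset.sum_add_distrib, ← hSsum]
    simp [mul_comm]
  rw [hlhs, hVsum, Finset.mul_sum]
  refine ⟨Finset.sum_le_sum fun x _ => hall x, fun hb => ?_⟩
  obtain ⟨e, he⟩ := hne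
  refine Finset.sum_lt_sum (fun x _ => hall x) ⟨mk (G.src e), Finset.mem_univ _, ?_⟩
  have := (hcount (mk (G.src e)) ⟨e, by simp [Sx, he]⟩).2 hb
  omega

/-- The `i`-th of the two vectors spanning the plane attached to the edge `e`. -/
noncomputable def liftVec [DecidableEq V] (G : LabeledGraph V E Γ) (L : Γ →+ Plane) (i : Fin 2)
    (e : E) : (V → Plane) × ℝ :=
  (Pi.single (G.src e) (EuclideanSpace.single i 1) -
      Pi.single (G.tgt e) (EuclideanSpace.single i 1),
    L (G.label e) i)

theorem dual_ext_single [Finite V] [DecidableEq V] {h : Module.Dual ℝ ((V → Plane) × ℝ)}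
    (h₁ : ∀ v i, h (Pi.single v (EuclideanSpace.single i 1), 0) = 0) (h₂ : h (0, 1) = 0) :
    h = 0 := by
  refine LinearMap.prod_ext (LinearMap.pi_ext' fun v => ?_) (LinearMap.ext_ring ?_)
  · refine (EuclideanSpace.basisFun (Fin 2) ℝ).toBasis.ext fun i => ?_
    simpa using h₁ v i
  · simpa using h₂

/-- This is the hypothesis of the general position lemma. A functional killing the span is a
placement `crd h` and a scalar `h (0, 1)` satisfying one vector equation per edge of `S`. Following
walks, it is determined by its values at one vertex per component and by the scalar. The scalar
vanishes if `S` is unbalanced, since a closed walk with nonzero label has nonzero image under `L`.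
So the annihilator has dimension at most `2c + 1` or `2c`, where `c` is the number of components,
and the component counts conclude. -/
theorem CountIndep.card_lt_finrank_span_liftVec [Finite V] [Finite E] [DecidableEq V]
    {G : LabeledGraph V E Γ} {L : Γ →+ Plane} (hL : Function.Injective L) {S : Set E}
    (hS : G.CountIndep S) (hne : S.Nonempty) :
    S.ncard + 1 ≤ Module.finrank ℝ
      (Submodule.span ℝ (G.liftVec L 0 '' S ∪ G.liftVec L 1 '' S)) := by
  classical
  have := Fintype.ofFinite V
  set W := Submodule.span ℝ (G.liftVec L 0 '' S ∪ G.liftVec L 1 '' S) with hW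
  have hdim := Subspace.finrank_add_finrank_dualAnnihilator_eq W
  rw [Module.finrank_prod, finrank_framework, Module.finrank_self] at hdim
  let Q := Quotient (G.walkSetoid S)
  have := Fintype.ofFinite Q
  have hc : S.ncard + 2 * Nat.card Q ≤ 2 * Nat.card V ∧
      (G.Balanced S → S.ncard + 2 * Nat.card Q + 1 ≤ 2 * Nat.card V) :=
    hS.ncard_add_components_le hne
  -- the coordinates of a functional
  let crd : Module.Dual ℝ ((V → Plane) × ℝ) → V → Plane := fun h v =>
    WithLp.toLp 2 fun i => h (Pi.single v (EuclideanSpace.single i 1), 0)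
  have hedge : ∀ h ∈ W.dualAnnihilator, ∀ e ∈ S,
      crd h (G.src e) - crd h (G.tgt e) + h (0, 1) • L (G.label e) = 0 := by
    intro h hh e he
    rw [Submodule.mem_dualAnnihilator] at hh
    have key : ∀ i, h (G.liftVec L i e) = 0 → (crd h (G.src e) - crd h (G.tgt e) +
        h (0, 1) • L (G.label e)) i = 0 := by
      intro i hi
      have hdec : G.liftVec L i e = (Pi.single (G.src e) (EuclideanSpace.single i 1), 0) -
          (Pi.single (G.tgt e) (EuclideanSpace.single i 1), 0) + L (G.label e) i • (0, 1) := by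
        simp [liftVec]
      rw [hdec, map_add, map_sub, map_smul] at hi
      simpa [crd, mul_comm] using hi
    ext i
    fin_cases i
    · exact key 0 (hh _ (Submodule.subset_span (.inl ⟨e, he, rfl⟩)))
    · exact key 1 (hh _ (Submodule.subset_span (.inr ⟨e, he, rfl⟩)))
  have hwalk : ∀ h ∈ W.dualAnnihilator, ∀ u w g, G.HasWalk S u w g →
      crd h u - crd h w + h (0, 1) • L g = 0 := by
    intro h hh u w g hg
    induction hg with
    | nil => simp
    | @forward e he w g _ ih =>
      have := hedge h hh e he
      rw [map_add, smul_add, ← add_zero (0 : Plane)]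
      nth_rewrite 1 [← this]
      rw [← ih]
      abel
    | @backward e he w g _ ih =>
      have := hedge h hh e he
      rw [map_add, map_neg, smul_add, smul_neg, ← sub_zero (0 : Plane)]
      nth_rewrite 1 [← ih]
      rw [← this]
      abel
  have hvanish : ∀ h ∈ W.dualAnnihilator, h (0, 1) = 0 →
      (∀ x : Q, crd h x.out = 0) → h = 0 := by
    intro h hh h0 hx
    refine dual_ext_single (fun v i => ?_) h0
    obtain ⟨g, hg⟩ : ∃ g, G.HasWalk S (Quotient.mk (G.walkSetoid S) v).out v g :=
      Quotient.mk_out (s := G.walkSetoid S) v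
    have h1 := hwalk h hh _ _ _ hg
    rw [hx, h0, zero_smul, add_zero, zero_sub, neg_eq_zero] at h1
    exact congrArg (fun y : Plane => y i) h1
  let Φ : W.dualAnnihilator →ₗ[ℝ] (Q → Plane) × ℝ :=
    { toFun := fun h => (fun x => crd h x.out, h.1 (0, 1))
      map_add' := fun a b => by
        ext <;> simp [crd]
      map_smul' := fun a b => by
        ext <;> simp [crd] }
  have hsub : ∀ a b : Module.Dual ℝ ((V → Plane) × ℝ), ∀ v, crd (a - b) v = crd a v - crd b v := by
    intro a b v; ext i; simp [crd]
  by_cases hb : G.Balanced S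
  · have hΦ : Function.Injective Φ := by
      intro a b hab
      refine Subtype.ext (sub_eq_zero.1 (hvanish _ (sub_mem a.2 b.2) ?_ fun x => ?_))
      · exact sub_eq_zero.2 (congrArg Prod.snd hab)
      · rw [hsub]
        exact sub_eq_zero.2 (congrFun (congrArg Prod.fst hab) x)
    have h1 := LinearMap.finrank_le_finrank_of_injective hΦ
    rw [Module.finrank_prod, finrank_framework, Module.finrank_self] at h1
    have := hc.2 hb
    omega
  · have hzero : ∀ h ∈ W.dualAnnihilator, h (0, 1) = 0 := by
      intro h hh
      unfold Balanced at hb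
      push Not at hb
      obtain ⟨v, g, hg, hg0⟩ := hb
      have h1 := hwalk h hh _ _ _ hg
      rw [sub_self, zero_add, smul_eq_zero] at h1
      exact h1.resolve_right fun h => hg0 ((map_eq_zero_iff L hL).1 h)
    have hΦ : Function.Injective (LinearMap.fst ℝ _ _ ∘ₗ Φ) := by
      intro a b hab
      have hm := sub_mem a.2 b.2
      refine Subtype.ext (sub_eq_zero.1 (hvanish _ hm (hzero _ hm) fun x => ?_))
      rw [hsub]
      exact sub_eq_zero.2 (congrFun hab x)
    have h1 := LinearMap.finrank_le_finrank_of_injective hΦ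
    rw [finrank_framework] at h1
    omega

/-- A set satisfying the counts has independent rows at some framework. -/
theorem CountIndep.exists_linearIndepOn_row [Finite V] [Finite E]
    {G : LabeledGraph V E Γ} {L : Γ →+ Plane} (hL : Function.Injective L) {F : Set E}
    (hF : G.CountIndep F) : ∃ q, LinearIndepOn ℝ (G.row L q) F := by
  classical
  have := Fintype.ofFinite V
  have := Fintype.ofFinite E
  obtain ⟨h, hh⟩ := exists_kernelVec_linearIndependent F.toFinset (G.liftVec L 0) (G.liftVec L 1)
    (by
      intro S hS hne
      have := (countIndep_mono hF (I := S) (fun e he => by simpa using hS he)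
        ).card_lt_finrank_span_liftVec hL (by simpa using hne)
      rwa [Set.ncard_coe_finset] at this)
  -- The last coordinate must not be killed, so that the functional can be rescaled to value -1
  -- there. It then evaluates on the two vectors of an edge to the coordinates of its edge vector in
  -- the framework `q`.
  obtain ⟨g, hg, hg1⟩ := exists_kernelVec_linearIndependent_ne_zero hh
    (y := ((0, 1) : (V → Plane) × ℝ)) (by simp)
  set s := g (0, 1) with hs
  let f : Module.Dual ℝ ((V → Plane) × ℝ) := (-s⁻¹) • g
  have hf1 : f (0, 1) = -1 := by simp [f, ← hs, hg1]
  have hf : LinearIndependent ℝ fun e : F.toFinset =>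
      kernelVec f (G.liftVec L 0 e) (G.liftVec L 1 e) := by
    have h1 : ∀ e, kernelVec f (G.liftVec L 0 e) (G.liftVec L 1 e) =
        (-s⁻¹) • kernelVec g (G.liftVec L 0 e) (G.liftVec L 1 e) := fun e => by
      simp only [kernelVec, f, LinearMap.smul_apply, smul_eq_mul]
      module
    simp only [h1]
    exact hg.units_smul fun _ => Units.mk0 (-s⁻¹) (by simp [hg1])
  let q : V → Plane := fun v =>
    WithLp.toLp 2 fun i => f (Pi.single v (EuclideanSpace.single i 1), 0)
  have hfl : ∀ i e, f (G.liftVec L i e) = G.edgeVec L q e i := by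
    intro i e
    have hdec : G.liftVec L i e = (Pi.single (G.src e) (EuclideanSpace.single i 1), 0) -
        (Pi.single (G.tgt e) (EuclideanSpace.single i 1), 0) + L (G.label e) i • (0, 1) := by
      simp [liftVec]
    rw [hdec, map_add, map_sub, map_smul, hf1]
    simp [edgeVec, q]
    ring
  -- Turning the gradient of a row by a right angle at every vertex gives the first component of the
  -- kernel vector. The real component is forced by `f` vanishing on that vector, so `Ψ` recovers
  -- it.
  let w : Module.Dual ℝ (V → Plane) →ₗ[ℝ] (V → Plane) :=
    { toFun := fun φ v => !₂[φ (Pi.single v (EuclideanSpace.single 1 1)),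
        -φ (Pi.single v (EuclideanSpace.single 0 1))]
      map_add' := fun a b => by ext v i; fin_cases i <;> simp [add_comm]
      map_smul' := fun a b => by ext v i; fin_cases i <;> simp }
  let Ψ : Module.Dual ℝ (V → Plane) →ₗ[ℝ] (V → Plane) × ℝ :=
    w.prod (f ∘ₗ LinearMap.inl ℝ (V → Plane) ℝ ∘ₗ w)
  have hΨ : ∀ e : F, Ψ (G.row L q e) = kernelVec f (G.liftVec L 0 e) (G.liftVec L 1 e) := by
    intro e
    have hw : w (G.row L q e) = (kernelVec f (G.liftVec L 0 e) (G.liftVec L 1 e)).1 := by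
      ext v i
      have h0 := G.row_single L q F e v 0
      have h1 := G.row_single L q F e v 1
      rw [kernelVec, hfl, hfl]
      have hne : G.src e ≠ G.tgt e := G.loopless e
      simp only [w, LinearMap.coe_mk, AddHom.coe_mk, h0, h1, coordMatrix, liftVec]
      rcases eq_or_ne v (G.src e) with rfl | h2
      · fin_cases i <;> simp [hne]
      · rcases eq_or_ne v (G.tgt e) with rfl | h3
        · fin_cases i <;> simp [hne.symm]
        · fin_cases i <;> simp [h2, h3]
    refine Prod.ext hw ?_
    have h1 := apply_kernelVec f (G.liftVec L 0 e) (G.liftVec L 1 e)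
    set k := kernelVec f (G.liftVec L 0 e) (G.liftVec L 1 e)
    have h2 : k = (k.1, 0) + k.2 • (0, 1) := by simp
    rw [h2, map_add, map_smul, hf1] at h1
    simp only [Ψ, LinearMap.prod_apply, Function.prod, LinearMap.comp_apply, hw,
      LinearMap.inl_apply]
    rw [smul_eq_mul] at h1
    linarith
  refine ⟨q, LinearIndependent.of_comp Ψ ?_⟩
  have h1 := hf.comp (fun e : F => (⟨e, by simp⟩ : F.toFinset))
    (fun a b hab => Subtype.ext (by simpa using hab))
  convert! h1 using 1
  ext1 e
  exact hΨ e

/-- For a generic framework the count matroid is the row matroid of the rigidity matrix. -/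
theorem Generic.linearIndepOn_row_iff [Finite V] [Finite E] {G : LabeledGraph V E Γ}
    {L : Γ →+ Plane} (hL : Function.Injective L) {p : V → Plane} (hp : Generic L p) {F : Set E} :
    LinearIndepOn ℝ (G.row L p) F ↔ G.CountIndep F :=
  ⟨hp.countIndep_of_linearIndepOn_row, fun h =>
    (h.exists_linearIndepOn_row hL).elim fun _ hq => hp.linearIndepOn_row hq⟩

/-! ### Rigid edge sets -/

/-- Every infinitesimal motion of `X` is trivial on `V(X)`. -/
structure RigidSet (G : LabeledGraph V E Γ) (L : Γ →+ Plane) (p : V → Plane) (X : Set E) :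
    Prop where
  translation : ¬ G.Balanced X →
    G.motions L p X ≤ agreeOn (translation V) (G.vertexSet X)
  euclidean : ∀ φ, G.IsPotential X φ →
    G.motions L p X ≤ agreeOn (euclidean L p φ) (G.vertexSet X)

/-- The motion at the two ends of the shared edge determines its translation and rotation parts, so
the descriptions on `X` and on `Y` agree. The delicate case is `X` and `Y` balanced with unbalanced
union, where the rotation has to be shown to vanish. -/
theorem RigidSet.union {G : LabeledGraph V E Γ} {L : Γ →+ Plane} (hL : Function.Injective L)
    {p : V → Plane} (hp : Generic L p) {X Y : Set E} (hX : G.RigidSet L p X)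
    (hY : G.RigidSet L p Y) {e : E} (heX : e ∈ X) (heY : e ∈ Y) : G.RigidSet L p (X ∪ Y) := by
  have hmX : G.motions L p (X ∪ Y) ≤ G.motions L p X := motions_anti Set.subset_union_left
  have hmY : G.motions L p (X ∪ Y) ≤ G.motions L p Y := motions_anti Set.subset_union_right
  have hsX := G.src_mem_vertexSet heX
  have htX := G.tgt_mem_vertexSet heX
  have hsY := G.src_mem_vertexSet heY
  have htY := G.tgt_mem_vertexSet heY
  have hrot : ∀ ω : ℝ, ω • quarterTurn (G.edgeVec L p e) = 0 → ω = 0 := fun ω h =>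
    (smul_eq_zero.1 h).resolve_right fun h => hp.edgeVec_ne_zero e (quarterTurn_eq_zero h)
  have hdiff : ∀ {Z : Set E} {φ : V → Γ}, G.IsPotential Z φ → e ∈ Z → ∀ s : Plane × ℝ,
      LabeledGraph.euclidean L p φ s (G.src e) - LabeledGraph.euclidean L p φ s (G.tgt e) =
        s.2 • quarterTurn (G.edgeVec L p e) := by
    intro Z φ hφ he s
    rw [euclidean_apply, euclidean_apply, add_sub_add_left_eq_sub, ← smul_sub, ← map_sub,
      ← hφ.edgeVec_eq L p he]
  constructor
  · intro hb m hm
    rw [vertexSet_union]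
    -- If one part is unbalanced, the shared edge only translates, so the other part cannot rotate
    -- either.
    have hmix : ∀ {A B : Set E}, G.RigidSet L p A → G.RigidSet L p B → m ∈ G.motions L p A →
        m ∈ G.motions L p B → e ∈ A → e ∈ B → ¬ G.Balanced A →
        m ∈ agreeOn (LabeledGraph.translation V) (G.vertexSet A ∪ G.vertexSet B) := by
      intro A B hA hB hmA hmB heA heB hbA
      obtain ⟨t, ht⟩ := hA.translation hbA hmA
      have h1 : m (G.src e) = t := ht _ (G.src_mem_vertexSet heA)
      have h2 : m (G.tgt e) = t := ht _ (G.tgt_mem_vertexSet heA)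
      refine ⟨t, ?_⟩
      rintro v (hv | hv)
      · exact ht v hv
      rw [translation_apply]
      by_cases hbB : G.Balanced B
      · obtain ⟨φ, hφ⟩ := (G.balanced_iff_potential B).1 hbB
        obtain ⟨s, hs⟩ := hB.euclidean φ hφ hmB
        have h3 := hs _ (G.src_mem_vertexSet heB)
        have h4 := hs _ (G.tgt_mem_vertexSet heB)
        have h5 : s.2 = 0 := by
          apply hrot
          rw [← hdiff hφ heB s, ← h3, ← h4, h1, h2]
          simp
        rw [hs v hv, ← h1, h3]
        simp [h5]
      · obtain ⟨t', ht'⟩ := hB.translation hbB hmB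
        rw [ht' v hv, ← h1, ht' _ (G.src_mem_vertexSet heB)]
        rfl
    by_cases hbX : G.Balanced X
    · by_cases hbY : G.Balanced Y
      · obtain ⟨φ, hφ⟩ := (G.balanced_iff_potential X).1 hbX
        obtain ⟨φ', hφ'⟩ := (G.balanced_iff_potential Y).1 hbY
        obtain ⟨s, hs⟩ := hX.euclidean φ hφ (hmX hm)
        obtain ⟨s', hs'⟩ := hY.euclidean φ' hφ' (hmY hm)
        have hω : s.2 = s'.2 := by
          have h1 := hdiff hφ heX s
          have h2 := hdiff hφ' heY s'
          rw [← hs _ hsX, ← hs _ htX] at h1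
          rw [← hs' _ hsY, ← hs' _ htY] at h2
          rw [← sub_eq_zero]
          apply hrot
          rw [sub_smul, ← h1, ← h2, sub_self]
        by_cases h0 : s.2 = 0
        · have h1 := hs _ hsX
          rw [hs' _ hsY] at h1
          simp only [euclidean_apply, ← hω, h0, zero_smul, add_zero] at h1
          refine ⟨s.1, ?_⟩
          rintro v (hv | hv)
          · rw [hs v hv]; simp [h0]
          · rw [hs' v hv]; simp [← hω, h0, h1]
        -- With a nonzero rotation, the agreement of both descriptions on common vertices makes `L
        -- (φ v - φ' v)` constant there. The two potentials then differ by a constant, which would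
        -- balance the union.
        · exfalso
          have key : ∀ v ∈ G.vertexSet X ∩ G.vertexSet Y,
              s.1 - s'.1 = s.2 • quarterTurn (L (φ v - φ' v)) := by
            rintro v ⟨hvX, hvY⟩
            have h1 := hs v hvX
            rw [hs' v hvY, euclidean_apply, euclidean_apply, ← hω] at h1
            rw [map_sub, map_sub, smul_sub]
            simp only [map_sub, smul_sub] at h1
            linear_combination (norm := module) (-1 : ℝ) • h1
          refine hb (balanced_union hφ hφ' (c := φ (G.src e) - φ' (G.src e)) fun v hv => ?_)
          have h1 := (key v hv).symm.trans (key _ ⟨hsX, hsY⟩)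
          have h2 := smul_right_injective Plane h0 h1
          apply hL
          rw [← sub_eq_zero]
          apply quarterTurn_eq_zero
          rw [map_sub, sub_eq_zero]
          exact h2
      · have := hmix hY hX (hmY hm) (hmX hm) heY heX hbY
        rwa [Set.union_comm] at this
    · exact hmix hX hY (hmX hm) (hmY hm) heX heY hbX
  · intro φ hφ m hm
    have hφX := hφ.mono (Set.subset_union_left (s := X) (t := Y))
    have hφY := hφ.mono (Set.subset_union_right (s := X) (t := Y))
    obtain ⟨s, hs⟩ := hX.euclidean φ hφX (hmX hm)
    obtain ⟨s', hs'⟩ := hY.euclidean φ hφY (hmY hm)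
    have hω : s.2 = s'.2 := by
      have h1 := hdiff hφX heX s
      have h2 := hdiff hφY heY s'
      rw [← hs _ hsX, ← hs _ htX] at h1
      rw [← hs' _ hsY, ← hs' _ htY] at h2
      rw [← sub_eq_zero]
      apply hrot
      rw [sub_smul, ← h1, ← h2, sub_self]
    have hss : s = s' := by
      refine Prod.ext ?_ hω
      have h1 := hs _ hsX
      rw [hs' _ hsY, euclidean_apply, euclidean_apply, hω] at h1
      exact (add_right_cancel h1).symm
    rw [vertexSet_union]
    refine ⟨s, ?_⟩
    rintro v (hv | hv)
    · exact hs v hv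
    · rw [hss]; exact hs' v hv

theorem countMatroid_indep_iff [Finite V] [Finite E] (G : LabeledGraph V E Γ) {I : Set E} :
    G.countMatroid.Indep I ↔ G.CountIndep I := Iff.rfl

/-- A circuit itself violates the counts. -/
theorem IsCircuit.ncard_lt [Finite V] [Finite E] {G : LabeledGraph V E Γ} {C : Set E}
    (hC : G.countMatroid.IsCircuit C) :
    2 * (G.vertexSet C).ncard < C.ncard + 2 ∨
      (G.Balanced C ∧ 2 * (G.vertexSet C).ncard < C.ncard + 3) := by
  have h := hC.not_indep
  rw [countMatroid_indep_iff] at h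
  unfold CountIndep at h
  push Not at h
  obtain ⟨X, hXC, hXne, hX⟩ := h
  have hXdep : ¬ G.countMatroid.Indep X := by
    intro hI
    have := hI X subset_rfl hXne
    obtain ⟨hb, hlt⟩ := hX this.1
    exact absurd (this.2 hb) (by omega)
  rw [hC.eq_of_not_indep_subset hXdep hXC] at hX
  by_cases h : C.ncard + 2 ≤ 2 * (G.vertexSet C).ncard
  · exact .inr (hX h)
  · exact .inl (by omega)

theorem IsCircuit.nontrivial [Finite V] [Finite E] {G : LabeledGraph V E Γ} {C : Set E}
    (hC : G.countMatroid.IsCircuit C) : C.Nontrivial := by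
  rw [← Set.one_lt_ncard_iff_nontrivial]
  have h1 := IsCircuit.ncard_lt hC
  have h2 := Set.one_lt_ncard_iff_nontrivial.2 (G.vertexSet_nontrivial hC.nonempty)
  omega

/-- Dimension count: `C \ {e}` has independent rows, and the violated count makes them numerous
enough to leave no room beyond the trivial motions. -/
theorem IsCircuit.rigidSet [Finite V] [Finite E] {G : LabeledGraph V E Γ} {L : Γ →+ Plane}
    (hL : Function.Injective L) {p : V → Plane} (hp : Generic L p) {C : Set E}
    (hC : G.countMatroid.IsCircuit C) : G.RigidSet L p C := by
  obtain ⟨e, he⟩ := hC.nonempty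
  have hI := (hp.linearIndepOn_row_iff hL).2
    ((G.countMatroid_indep_iff).1 (hC.sdiff_singleton_indep he))
  have h1 := ncard_add_finrank_motions hI
  have h2 := Submodule.finrank_mono (motions_anti (G := G) (L := L) (p := p)
    (Set.sdiff_subset (s := C) (t := {e})))
  have h3 := Set.ncard_sdiff_singleton_add_one he
  have h4 := IsCircuit.ncard_lt hC
  have hV := G.vertexSet_nontrivial hC.nonempty
  constructor
  · intro hb
    have h5 := finrank_agreeOn_translation hV.nonempty
    have h6 : 2 * (G.vertexSet C).ncard < C.ncard + 2 := h4.resolve_right fun h => hb h.1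
    exact (Submodule.eq_of_le_of_finrank_le (G.agreeOn_translation_le_motions L p C)
      (by omega)).ge
  · intro φ hφ
    have h5 := finrank_agreeOn_euclidean hp φ hV
    exact (Submodule.eq_of_le_of_finrank_le (agreeOn_euclidean_le_motions hφ L p)
      (by omega)).ge

/-- The row of `e` is a combination of the other rows of the circuit, so deleting `e` creates no new
motion. -/
theorem IsCircuit.row_eq_zero [Finite V] [Finite E] {G : LabeledGraph V E Γ} {L : Γ →+ Plane}
    (hL : Function.Injective L) {p : V → Plane} (hp : Generic L p) {C : Set E}
    (hC : G.countMatroid.IsCircuit C) {e : E} (he : e ∈ C) {m : V → Plane}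
    (hm : m ∈ G.motions L p (C \ {e})) : G.row L p e m = 0 := by
  have hI := (hp.linearIndepOn_row_iff hL).2
    ((G.countMatroid_indep_iff).1 (hC.sdiff_singleton_indep he))
  refine row_eq_zero_of_mem_span ?_ hm
  rw [hI.mem_span_iff, Set.insert_sdiff_singleton, Set.insert_eq_of_mem he]
  intro h
  exact absurd ((hp.linearIndepOn_row_iff hL).1 h) hC.not_indep

/-! ### Components of the count matroid -/

/-- `e` and `f` are equal or lie in a common circuit. -/
def circuitSetoid [Finite V] [Finite E] (G : LabeledGraph V E Γ) : Setoid E where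
  r e f := e = f ∨ ∃ C, G.countMatroid.IsCircuit C ∧ e ∈ C ∧ f ∈ C
  iseqv :=
    { refl := fun _ => .inl rfl
      symm := by
        rintro e f (rfl | ⟨C, hC, he, hf⟩)
        · exact .inl rfl
        · exact .inr ⟨C, hC, hf, he⟩
      trans := by
        rintro e f g (rfl | ⟨C, hC, he, hf⟩) (rfl | ⟨C', hC', hf', hg⟩)
        · exact .inl rfl
        · exact .inr ⟨C', hC', hf', hg⟩
        · exact .inr ⟨C, hC, he, hf⟩
        · exact .inr (hC.exists_mem_mem_of_inter_nonempty hC' he hg ⟨f, hf, hf'⟩) }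

theorem rigidSet_biUnion [Finite V] [Finite E] {G : LabeledGraph V E Γ} {L : Γ →+ Plane}
    (hL : Function.Injective L) {p : V → Plane} (hp : Generic L p) {e : E}
    (s : Finset (Set E)) (hs : s.Nonempty) (h : ∀ C ∈ s, G.countMatroid.IsCircuit C ∧ e ∈ C) :
    G.RigidSet L p (⋃ C ∈ s, C) := by
  classical
  induction hs using Finset.Nonempty.cons_induction with
  | singleton C => simpa using IsCircuit.rigidSet hL hp (h C (by simp)).1
  | cons C s hC hs ih =>
    have hu : (⋃ D ∈ Finset.cons C s hC, D) = C ∪ ⋃ D ∈ s, D := by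
      ext x; simp
    rw [hu]
    obtain ⟨D, hD⟩ := hs
    have h1 := h C (by simp)
    refine (IsCircuit.rigidSet hL hp h1.1).union hL hp
      (ih fun D hD => h D (by simp [hD])) h1.2 (e := e) ?_
    simp only [Set.mem_iUnion]
    exact ⟨D, hD, (h D (by simp [hD])).2⟩

/-- A component of the count matroid that contains a circuit is rigid. -/
theorem rigidSet_component [Finite V] [Finite E] {G : LabeledGraph V E Γ} {L : Γ →+ Plane}
    (hL : Function.Injective L) {p : V → Plane} (hp : Generic L p) {e : E}
    (he : ∃ C, G.countMatroid.IsCircuit C ∧ e ∈ C) :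
    G.RigidSet L p {f | G.circuitSetoid.r e f} := by
  classical
  have := Fintype.ofFinite E
  obtain ⟨C, hC, heC⟩ := he
  have h := rigidSet_biUnion hL hp (e := e)
    (Finset.univ.filter fun C => G.countMatroid.IsCircuit C ∧ e ∈ C) ⟨C, by simp [hC, heC]⟩
    (fun D hD => by simpa using hD)
  convert! h using 1
  ext f
  simp only [Finset.mem_filter, Finset.mem_univ, true_and, Set.mem_iUnion, exists_prop]
  constructor
  · rintro (rfl | ⟨D, hD, heD, hfD⟩)
    · exact ⟨C, ⟨hC, heC⟩, heC⟩
    · exact ⟨D, ⟨hD, heD⟩, hfD⟩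
  · rintro ⟨D, ⟨hD, heD⟩, hfD⟩
    exact .inr ⟨D, hD, heD, hfD⟩

theorem vertexSet_univ {G : LabeledGraph V E Γ} (hiso : ∀ v, ∃ e, G.src e = v ∨ G.tgt e = v) :
    G.vertexSet Set.univ = Set.univ :=
  Set.eq_univ_of_forall fun v => (hiso v).elim fun e he => ⟨e, trivial, he⟩

theorem MConnected.exists_isCircuit [Finite V] [Finite E] {G : LabeledGraph V E Γ}
    (hG : G.MConnected) (e : E) :
    ∃ C, G.countMatroid.IsCircuit C ∧ e ∈ C := by
  obtain ⟨f, -, hf⟩ := hG.1.exists_ne e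
  rcases hG.2 e trivial f trivial with h | ⟨C, hC, he, -⟩
  · exact absurd h.symm hf
  · exact ⟨C, hC, he⟩

/-- In an M-connected unbalanced graph every infinitesimal motion of `G - e` is a translation. -/
theorem MConnected.motions_le [Finite V] [Finite E] {G : LabeledGraph V E Γ} (hG : G.MConnected)
    (hiso : ∀ v, ∃ e, G.src e = v ∨ G.tgt e = v) (hunb : ¬ G.Balanced Set.univ)
    {L : Γ →+ Plane} (hL : Function.Injective L) {p : V → Plane} (hp : Generic L p) (e : E) :
    G.motions L p {e}ᶜ ≤ agreeOn (translation V) Set.univ := by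
  have h := rigidSet_component hL hp (hG.exists_isCircuit e)
  have huniv : {f | G.circuitSetoid.r e f} = Set.univ :=
    Set.eq_univ_of_forall fun f => hG.2 e trivial f trivial
  rw [huniv] at h
  have h1 := h.translation hunb
  rw [vertexSet_univ hiso] at h1
  refine fun m hm => h1 fun f _ => ?_
  by_cases hf : f = e
  · subst hf
    obtain ⟨C, hC, hfC⟩ := hG.exists_isCircuit f
    exact IsCircuit.row_eq_zero hL hp hC hfC (motions_anti (fun g hg => hg.2) hm)
  · exact hm f hf

/-- The edge sets of an M-connected graph meet their complements in at least two vertices. -/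
theorem MConnected.two_le_ncard [Finite V] [Finite E] {G : LabeledGraph V E Γ}
    (hG : G.MConnected) {A : Set E}
    (hA : A.Nonempty) (hA' : Aᶜ.Nonempty) :
    2 ≤ (G.vertexSet A ∩ G.vertexSet Aᶜ).ncard := by
  obtain ⟨a, ha⟩ := hA
  obtain ⟨b, hb⟩ := hA'
  rcases hG.2 a trivial b trivial with rfl | ⟨C, hC, haC, hbC⟩
  · exact absurd ha hb
  -- Both pieces of the circuit are independent. Adding their two counts and comparing with the
  -- count violated by `C` bounds the number of shared vertices from below.
  have hi1 := hC.ssubset_indep (X := C ∩ A)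
    ((Set.ssubset_iff_of_subset Set.inter_subset_left).2 ⟨b, hbC, fun h => hb h.2⟩)
  have hi2 := hC.ssubset_indep (X := C ∩ Aᶜ)
    ((Set.ssubset_iff_of_subset Set.inter_subset_left).2 ⟨a, haC, fun h => h.2 ha⟩)
  have h1 := hi1 _ subset_rfl ⟨a, haC, ha⟩
  have h2 := hi2 _ subset_rfl ⟨b, hbC, hb⟩
  have hCd : C ∩ A ∪ C ∩ Aᶜ = C := Set.inter_union_compl C A
  have h3 : (C ∩ A).ncard + (C ∩ Aᶜ).ncard = C.ncard := by
    rw [← Set.ncard_union_eq, hCd]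
    exact Set.disjoint_left.2 fun x hx hx' => hx'.2 hx.2
  have h4 := Set.ncard_union_add_ncard_inter (G.vertexSet (C ∩ A)) (G.vertexSet (C ∩ Aᶜ))
  rw [← vertexSet_union, hCd] at h4
  have h5 : (G.vertexSet (C ∩ A) ∩ G.vertexSet (C ∩ Aᶜ)).ncard ≤
      (G.vertexSet A ∩ G.vertexSet Aᶜ).ncard :=
    Set.ncard_le_ncard (Set.inter_subset_inter (G.vertexSet_mono Set.inter_subset_right)
      (G.vertexSet_mono Set.inter_subset_right)) (Set.toFinite _)
  rcases IsCircuit.ncard_lt hC with h | ⟨hbal, h⟩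
  · omega
  · have h6 := h1.2 (hbal.mono Set.inter_subset_left)
    have h7 := h2.2 (hbal.mono Set.inter_subset_left)
    omega

/-! ### Two-connectivity in terms of edge cuts -/

/-- If the two sides share at most `v`, a walk avoiding `v` cannot pass from edges of `A` to edges
of its complement. -/
theorem TwoConnected.two_le_ncard [Finite V] {G : LabeledGraph V E Γ}
    (hG : G.TwoConnected) {A : Set E}
    (hA : A.Nonempty) (hA' : Aᶜ.Nonempty) :
    2 ≤ (G.vertexSet A ∩ G.vertexSet Aᶜ).ncard := by
  by_contra! hlt
  obtain ⟨v, hv⟩ : ∃ v, G.vertexSet A ∩ G.vertexSet Aᶜ ⊆ {v} := by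
    have := hG.1.to_nonempty
    exact (Set.ncard_le_one_iff_subset_singleton (Set.toFinite _)).1 (by omega)
  have hend : ∀ {B : Set E}, B.Nonempty → ∃ x ∈ G.vertexSet B, x ≠ v := by
    intro B hB
    obtain ⟨x, hx, hne⟩ := (G.vertexSet_nontrivial hB).exists_ne v
    exact ⟨x, hx, hne⟩
  obtain ⟨x, hx, hxv⟩ := hend hA
  obtain ⟨y, hy, hyv⟩ := hend hA'
  have key : ∀ z w : ({v}ᶜ : Set V),
      (G.toSimpleGraph.induce {v}ᶜ).Reachable z w → (z : V) ∈ G.vertexSet A →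
      (w : V) ∈ G.vertexSet A := by
    rintro z w ⟨W⟩ hz
    induction W with
    | nil => exact hz
    | @cons a b c hab _ ih =>
      refine ih ?_
      obtain ⟨e, he⟩ := hab
      by_cases heA : e ∈ A
      · rcases he with ⟨-, h⟩ | ⟨h, -⟩
        · exact ⟨e, heA, .inr h⟩
        · exact ⟨e, heA, .inl h⟩
      · refine absurd (hv ⟨hz, ?_⟩) a.2
        rcases he with ⟨h, -⟩ | ⟨-, h⟩
        · exact ⟨e, heA, .inl h⟩
        · exact ⟨e, heA, .inr h⟩
  have := key ⟨x, hxv⟩ ⟨y, hyv⟩ ((hG.2.2 v).preconnected _ _) hx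
  exact hyv (hv ⟨this, hy⟩)

/-- If `G - v` were disconnected, the edges touching the component of one vertex `x` would meet the
remaining edges at most in `v`. Connectivity of `G` follows from that of `G - x` and an edge at `x`.
-/
theorem twoConnected_of_two_le_ncard [Finite V] {G : LabeledGraph V E Γ} (hV : Nontrivial V)
    (hiso : ∀ v, ∃ e, G.src e = v ∨ G.tgt e = v)
    (h : ∀ A : Set E, A.Nonempty → Aᶜ.Nonempty → 2 ≤ (G.vertexSet A ∩ G.vertexSet Aᶜ).ncard) :
    G.TwoConnected := by
  have hind : ∀ v, (G.toSimpleGraph.induce {v}ᶜ).Connected := by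
    intro v
    have hne : Nonempty ({v}ᶜ : Set V) := (exists_ne v).elim fun w hw => ⟨w, hw⟩
    refine { preconnected := fun x y => ?_, nonempty := hne }
    by_contra hxy
    let X : Set V := {z | ∃ hz : z ≠ v, (G.toSimpleGraph.induce {v}ᶜ).Reachable x ⟨z, hz⟩}
    let A : Set E := {e | G.src e ∈ X ∨ G.tgt e ∈ X}
    have hstep : ∀ e, ∀ z w, (G.src e = z ∧ G.tgt e = w) ∨ (G.src e = w ∧ G.tgt e = z) →
        z ∈ X → w ≠ v → w ∈ X := by
      rintro e z w hzw ⟨hz, hr⟩ hw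
      refine ⟨hw, hr.trans (SimpleGraph.Adj.reachable ?_)⟩
      exact ⟨e, hzw⟩
    have hVA : G.vertexSet A ⊆ insert v X := by
      rintro z ⟨e, he, hz⟩
      by_cases hzv : z = v
      · exact .inl hzv
      refine .inr ?_
      rcases hz with rfl | rfl
      · rcases he with he | he
        · exact he
        · exact hstep e _ _ (.inr ⟨rfl, rfl⟩) he hzv
      · rcases he with he | he
        · exact hstep e _ _ (.inl ⟨rfl, rfl⟩) he hzv
        · exact he
    have hVA' : ∀ z ∈ G.vertexSet Aᶜ, z ∉ X := by
      rintro z ⟨e, he, rfl | rfl⟩ hz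
      · exact he (.inl hz)
      · exact he (.inr hz)
    have hxX : (x : V) ∈ X := ⟨x.2, .refl _⟩
    have hyX : (y : V) ∉ X := fun ⟨_, hr⟩ => hxy hr
    have hA : A.Nonempty := by
      obtain ⟨e, he | he⟩ := hiso x
      · exact ⟨e, .inl (he ▸ hxX)⟩
      · exact ⟨e, .inr (he ▸ hxX)⟩
    have hA' : Aᶜ.Nonempty := by
      obtain ⟨e, he⟩ := hiso y
      refine ⟨e, fun heA => ?_⟩
      rcases hVA ⟨e, heA, he⟩ with h | h
      · exact y.2 h
      · exact hyX h
    have h2 := h A hA hA'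
    have h3 : (G.vertexSet A ∩ G.vertexSet Aᶜ).ncard ≤ ({v} : Set V).ncard := by
      refine Set.ncard_le_ncard ?_ (Set.toFinite _)
      rintro z ⟨hz, hz'⟩
      exact (hVA hz).resolve_right (hVA' z hz')
    rw [Set.ncard_singleton] at h3
    omega
  refine ⟨hV, { preconnected := fun x y => ?_, nonempty := hV.to_nonempty }, hind⟩
  by_cases hxy : y = x
  · subst hxy; rfl
  obtain ⟨x', hx'⟩ : ∃ x', G.toSimpleGraph.Adj x x' := by
    obtain ⟨e, he | he⟩ := hiso x
    · exact ⟨G.tgt e, e, .inl ⟨he, rfl⟩⟩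
    · exact ⟨G.src e, e, .inr ⟨rfl, he⟩⟩
  have h1 := (hind x).preconnected ⟨x', hx'.ne'⟩ ⟨y, hxy⟩
  exact hx'.reachable.trans (h1.map (SimpleGraph.Embedding.induce _).toHom)

/-! ### From redundant rigidity to M-connectivity -/

theorem Balanced.rank_eq_zero {G : LabeledGraph V E Γ} {F : Set E} (h : G.Balanced F) :
    G.rank F = 0 := by
  have : G.gainGroup F = ⊥ := by
    rw [gainGroup, AddSubgroup.closure_eq_bot_iff]
    rintro g ⟨v, hv⟩
    exact h v g hv
  rw [rank, this]
  exact Module.finrank_zero_of_subsingleton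

/-- A balanced set with two edges has at least three vertices. -/
theorem Balanced.three_le_ncard [Finite V] {G : LabeledGraph V E Γ} {F : Set E} (h : G.Balanced F)
    (hF : F.Nontrivial) : 3 ≤ (G.vertexSet F).ncard := by
  obtain ⟨e, he, f, hf, hef⟩ := hF
  obtain ⟨φ, hφ⟩ := (G.balanced_iff_potential F).1 h
  by_contra! hlt
  have hV : G.vertexSet F = {G.src e, G.tgt e} := by
    refine (Set.eq_of_subset_of_ncard_le ?_ ?_ (Set.toFinite _)).symm
    · rintro v (rfl | rfl)
      · exact G.src_mem_vertexSet he
      · exact G.tgt_mem_vertexSet he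
    · rw [Set.ncard_pair (G.loopless e)]
      omega
  have h1 : G.src f ∈ ({G.src e, G.tgt e} : Set V) := hV ▸ G.src_mem_vertexSet hf
  have h2 : G.tgt f ∈ ({G.src e, G.tgt e} : Set V) := hV ▸ G.tgt_mem_vertexSet hf
  have h3 := G.semisimple e f hef
  have h4 := G.loopless f
  have h5 := hφ e he
  have h6 := hφ f hf
  rcases h1 with h1 | h1 <;> rcases h2 with h2 | h2
  · exact h4 (h1.trans h2.symm)
  · exact h3.1 ⟨h1.symm, h2.symm, by rw [h5, h6, h1, h2]⟩
  · exact h3.2 ⟨h2.symm, h1.symm, by rw [h5, h6, h1, h2]; abel⟩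
  · exact h4 (h1.trans h2.symm)

/-- The number of base elements in a rigid component. -/
theorem two_mul_ncard_vertexSet_le [Finite V] [Finite E] {G : LabeledGraph V E Γ} {L : Γ →+ Plane}
    (hL : Function.Injective L) {p : V → Plane} (hp : Generic L p) {B D : Set E}
    (hB : G.countMatroid.IsBase B) (hne : D.Nonempty) (hD : G.RigidSet L p D)
    (hcl : ∀ C, G.countMatroid.IsCircuit C → ∀ e ∈ C, e ∈ D → C ⊆ D) :
    2 * (G.vertexSet D).ncard ≤ (B ∩ D).ncard + 3 ∧
      (¬ G.Balanced D → 2 * (G.vertexSet D).ncard ≤ (B ∩ D).ncard + 2) := by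
  have hI := (hp.linearIndepOn_row_iff hL).2
    (countIndep_mono ((G.countMatroid_indep_iff).1 hB.indep) (Set.inter_subset_left (t := D)))
  have h1 := ncard_add_finrank_motions hI
  -- An edge of `D` outside the base depends on its fundamental circuit, which stays inside `D` by
  -- `hcl`.
  have h2 : G.motions L p (B ∩ D) ≤ G.motions L p D := by
    intro m hm e he
    by_cases heB : e ∈ B
    · exact hm e ⟨heB, he⟩
    have hC := hB.fundCircuit_isCircuit (x := e) trivial heB
    have heC := G.countMatroid.mem_fundCircuit e B
    refine IsCircuit.row_eq_zero hL hp hC heC (motions_anti ?_ hm)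
    rintro f ⟨hf, hfe⟩
    exact ⟨(G.countMatroid.fundCircuit_subset_insert e B hf).resolve_left hfe,
      hcl _ hC e heC he hf⟩
  have h3 := Submodule.finrank_mono h2
  have hV := G.vertexSet_nontrivial hne
  have h4 := finrank_agreeOn_translation hV.nonempty
  have hun : ¬ G.Balanced D → 2 * (G.vertexSet D).ncard ≤ (B ∩ D).ncard + 2 := by
    intro hb
    have h5 := Submodule.finrank_mono (hD.translation hb)
    omega
  refine ⟨?_, hun⟩
  by_cases hb : G.Balanced D
  · obtain ⟨φ, hφ⟩ := (G.balanced_iff_potential D).1 hb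
    have h5 := Submodule.finrank_mono (hD.euclidean φ hφ)
    have h6 := finrank_agreeOn_euclidean hp φ hV
    omega
  · have := hun hb
    omega

/-- With at least two matroid components, every component `D` with attachment set `Y` contributes at
least `|V(D)| + |V(D) \ Y|` edges to a base. Summing yields at least `2|V|`, more than the counts
allow. -/
theorem mConnected_of_forall_exists_isCircuit [Finite V] [Finite E] {G : LabeledGraph V E Γ}
    (hiso : ∀ v, ∃ e, G.src e = v ∨ G.tgt e = v) (hV : Nonempty V)
    (hblock : ¬ ∃ H : G.Subgraph, H.IsBlock 0 2)
    (hcut : ∀ A : Set E, A.Nonempty → Aᶜ.Nonempty → 2 ≤ (G.vertexSet A ∩ G.vertexSet Aᶜ).ncard)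
    (hcirc : ∀ e, ∃ C, G.countMatroid.IsCircuit C ∧ e ∈ C)
    {L : Γ →+ Plane} (hL : Function.Injective L) {p : V → Plane} (hp : Generic L p) :
    G.MConnected := by
  classical
  have := Fintype.ofFinite V
  have := Fintype.ofFinite E
  refine ⟨?_, fun e₀ _ f₀ _ => ?_⟩
  · obtain ⟨v⟩ := hV
    obtain ⟨e, -⟩ := hiso v
    obtain ⟨C, hC, -⟩ := hcirc e
    exact (IsCircuit.nontrivial hC).mono (Set.subset_univ _)
  by_contra hnot
  let Q := Quotient G.circuitSetoid
  have := Fintype.ofFinite Q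
  let mk : E → Q := Quotient.mk _
  have hmk : ∀ e f, mk e = mk f ↔ G.circuitSetoid.r e f := fun e f => Quotient.eq
  have hne₀ : mk e₀ ≠ mk f₀ := fun h => hnot ((hmk _ _).1 h)
  let D : Q → Set E := fun x => {e | mk e = x}
  have hDne : ∀ x, (D x).Nonempty := fun x => Quotient.exists_rep x
  have hDne' : ∀ x, (D x)ᶜ.Nonempty := fun x => by
    by_cases h : mk e₀ = x
    · exact ⟨f₀, fun h' => hne₀ (h.trans h'.symm)⟩
    · exact ⟨e₀, h⟩
  have hcl : ∀ x C, G.countMatroid.IsCircuit C → ∀ e ∈ C, e ∈ D x → C ⊆ D x := by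
    intro x C hC e he heD f hf
    exact ((hmk f e).2 (.inr ⟨C, hC, hf, he⟩)).trans heD
  have hrig : ∀ x, G.RigidSet L p (D x) := by
    intro x
    obtain ⟨e, rfl⟩ := hDne x
    convert! rigidSet_component hL hp (hcirc e) using 1
    ext f
    exact eq_comm.trans (hmk e f)
  obtain ⟨B, hB⟩ := G.countMatroid.exists_isBase
  let VD : Q → Set V := fun x => G.vertexSet (D x)
  let YD : Q → Set V := fun x => G.vertexSet (D x) ∩ G.vertexSet (D x)ᶜ
  -- An unbalanced component falls short by at most 2, which `|Y| ≥ 2` covers. A balanced one may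
  -- fall short by 3; but if `|Y| = 2` its at least three vertices include an inner one, so it would
  -- be a (0,2)-block.
  have hbound : ∀ x, 2 * (VD x).ncard ≤ (B ∩ D x).ncard + (YD x).ncard := by
    intro x
    have h1 := two_mul_ncard_vertexSet_le hL hp hB (hDne x) (hrig x) (hcl x)
    have h2 : 2 ≤ (YD x).ncard := hcut _ (hDne x) (hDne' x)
    by_cases hb : G.Balanced (D x)
    · suffices (YD x).ncard ≠ 2 by
        have := h1.1
        change 2 * (VD x).ncard ≤ _ at this
        omega
      intro h3
      refine hblock ⟨⟨VD x, D x, fun e he => G.src_mem_vertexSet he,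
        fun e he => G.tgt_mem_vertexSet he⟩, hb.rank_eq_zero, h3, ?_⟩
      have h4 : 3 ≤ (VD x).ncard := by
        refine hb.three_le_ncard ?_
        obtain ⟨e, he⟩ := hDne x
        obtain ⟨C, hC, heC⟩ := hcirc e
        exact (IsCircuit.nontrivial hC).mono (hcl x C hC e heC he)
      change (VD x \ YD x).Nonempty
      rw [← Set.ncard_pos (Set.toFinite _)]
      have h5 := Set.ncard_sdiff_add_ncard_of_subset (s := YD x) (t := VD x)
        Set.inter_subset_left (Set.toFinite _)
      omega
    · have := h1.2 hb
      change 2 * (VD x).ncard ≤ _ at this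
      omega
  have hBsum : B.ncard = ∑ x, (B ∩ D x).ncard := by
    rw [Set.ncard_eq_toFinset_card',
      Finset.card_eq_sum_card_fiberwise (f := mk) (t := Finset.univ) fun e _ => Finset.mem_univ _]
    refine Finset.sum_congr rfl fun x _ => ?_
    rw [← Set.ncard_coe_finset]
    congr 1
    ext e
    simp [D]
  -- The counts speak of nonempty sets only. A circuit has at least two elements, so its singletons
  -- are independent and no base is empty.
  have hBne : B.Nonempty := by
    by_contra hemp
    rw [Set.not_nonempty_iff_eq_empty] at hemp
    obtain ⟨C, hC, -⟩ := hcirc e₀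
    obtain ⟨e, he⟩ := hC.nonempty
    have h1 : G.countMatroid.Indep {e} := by
      obtain ⟨f, hf, hfe⟩ := (IsCircuit.nontrivial hC).exists_ne e
      exact hC.ssubset_indep ((Set.ssubset_iff_of_subset (by simpa using he)).2
        ⟨f, hf, by simpa using hfe⟩)
    have h2 := hB.eq_of_subset_indep h1 (by simp [hemp])
    rw [hemp] at h2
    exact (Set.singleton_ne_empty e) h2.symm
  have hBcard : B.ncard + 2 ≤ 2 * Nat.card V := by
    have h1 := (hB.indep B subset_rfl hBne).1
    have h2 := Set.ncard_le_card (G.vertexSet B)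
    omega
  -- A vertex weighs 2 in a component where it is inner and 1 where it is an attachment. An
  -- attachment vertex lies in a second component, so every vertex has total weight at least 2.
  let w : Q → V → ℕ := fun x v => (if v ∈ VD x then 1 else 0) + (if v ∈ VD x \ YD x then 1 else 0)
  have hw : ∀ x, ∑ v, w x v + (YD x).ncard = 2 * (VD x).ncard := by
    intro x
    have h5 := Set.ncard_sdiff_add_ncard_of_subset (s := YD x) (t := VD x)
      Set.inter_subset_left (Set.toFinite _)
    have hsum : ∀ (S : Set V) [DecidablePred (· ∈ S)],
        ∑ v, (if v ∈ S then 1 else 0) = S.ncard := by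
      intro S _
      rw [Set.ncard_eq_toFinset_card', Finset.sum_boole]
      simp only [Nat.cast_id]
      congr 1
      ext v; simp
    have hwsum : ∑ v, w x v = (VD x).ncard + (VD x \ YD x).ncard := by
      simp only [w, Finset.sum_add_distrib]
      exact congrArg₂ _ (hsum _) (hsum _)
    omega
  have hv : ∀ v, 2 ≤ ∑ x, w x v := by
    intro v
    obtain ⟨e, he⟩ := hiso v
    have hvD : v ∈ VD (mk e) := ⟨e, rfl, he⟩
    by_cases hvY : v ∈ YD (mk e)
    · obtain ⟨f, hf, hfv⟩ := hvY.2
      have hvD' : v ∈ VD (mk f) := ⟨f, rfl, hfv⟩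
      have hne : mk e ≠ mk f := fun h => hf h.symm
      calc 2 ≤ w (mk e) v + w (mk f) v := by simp only [w, hvD, hvD', if_true]; omega
        _ = ∑ x ∈ {mk e, mk f}, w x v := (Finset.sum_pair (f := fun x => w x v) hne).symm
        _ ≤ ∑ x, w x v := Finset.sum_le_sum_of_subset (Finset.subset_univ _)
    · calc 2 = w (mk e) v := by simp [w, hvD, hvY]
        _ ≤ ∑ x, w x v := Finset.single_le_sum (f := fun x => w x v)
            (fun _ _ => Nat.zero_le _) (Finset.mem_univ _)
  have h1 : 2 * Nat.card V ≤ ∑ x, ∑ v, w x v := by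
    rw [Finset.sum_comm, Nat.card_eq_fintype_card, ← Finset.card_univ, mul_comm, ← smul_eq_mul,
      ← Finset.sum_const]
    exact Finset.sum_le_sum fun v _ => hv v
  have h2 : ∑ x, ∑ v, w x v ≤ ∑ x, (B ∩ D x).ncard := by
    refine Finset.sum_le_sum fun x _ => ?_
    have := hw x
    have := hbound x
    omega
  omega

/-- If every infinitesimal motion of `G - e` is a translation then `e` lies in a circuit. -/
theorem exists_isCircuit_of_motions_le [Finite V] [Finite E] {G : LabeledGraph V E Γ}
    {L : Γ →+ Plane} (hL : Function.Injective L) {p : V → Plane} (hp : Generic L p) {e : E}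
    (h : G.motions L p {e}ᶜ ≤ agreeOn (translation V) Set.univ) :
    ∃ C, G.countMatroid.IsCircuit C ∧ e ∈ C := by
  have hmem : G.row L p e ∈ Submodule.span ℝ (G.row L p '' {e}ᶜ) := by
    refine row_mem_span_of_motions_le fun m hm => ?_
    obtain ⟨t, ht⟩ := h hm
    rw [row_apply, ht _ trivial, ht _ trivial]
    simp
  obtain ⟨I, hIe, -, hspan, hI⟩ := exists_linearIndepOn_extension
    (linearIndepOn_empty ℝ (G.row L p)) (Set.empty_subset ({e}ᶜ : Set E))
  have hmem' : G.row L p e ∈ Submodule.span ℝ (G.row L p '' I) :=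
    Submodule.span_le.2 hspan hmem
  have heI : e ∉ I := fun h => hIe h rfl
  have hdep : ¬ G.CountIndep (insert e I) := by
    intro hc
    rw [← hp.linearIndepOn_row_iff hL, linearIndepOn_insert heI] at hc
    exact hc.2 hmem'
  have hIind : G.countMatroid.Indep I := (hp.linearIndepOn_row_iff hL).1 hI
  have hecl : e ∈ G.countMatroid.closure I := by
    rw [hIind.mem_closure_iff]
    exact .inl ⟨hdep, Set.subset_univ _⟩
  exact ⟨_, hIind.fundCircuit_isCircuit hecl heI, G.countMatroid.mem_fundCircuit e I⟩

/-! ### Local rigidity -/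

/-- Infinitesimal rigidity implies rigidity. -/
theorem lPeriodicallyRigid_of_motions_le [Finite V] [Finite E] {G : LabeledGraph V E Γ}
    {L : Γ →+ Plane} {p : V → Plane}
    (h : G.motions L p Set.univ ≤ agreeOn (translation V) Set.univ) :
    G.LPeriodicallyRigid L p := by
  classical
  have := Fintype.ofFinite V
  have := Fintype.ofFinite E
  rcases isEmpty_or_nonempty V with hV | ⟨⟨v₀⟩⟩
  · exact Eventually.of_forall fun q _ u => hV.elim u
  -- Recording the motion of one vertex removes the translations and makes `R` injective, hence
  -- bounded below.
  let R : (V → Plane) →ₗ[ℝ] (E → ℝ) × Plane :=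
    (LinearMap.pi fun e => G.row L p e).prod (LinearMap.proj v₀)
  have hR : LinearMap.ker R = ⊥ := by
    rw [LinearMap.ker_eq_bot']
    intro m hm
    obtain ⟨t, ht⟩ := h (show m ∈ G.motions L p Set.univ from
      fun e _ => congrFun (congrArg Prod.fst hm) e)
    have h0 : m v₀ = 0 := congrArg Prod.snd hm
    have ht0 : t = 0 := by rw [← h0, ht v₀ trivial]; rfl
    ext1 v
    rw [ht v trivial, ht0]; simp
  obtain ⟨K, hK, hanti⟩ := R.exists_antilipschitzWith hR
  have hbound : ∀ m, ‖m‖ ≤ K * ‖R m‖ := fun m => by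
    simpa using hanti.le_mul_dist m 0
  have hnear : ∀ᶠ q in 𝓝 p, 4 * (K : ℝ) * ‖q - p‖ < 1 := by
    have hc : Continuous fun q : V → Plane => 4 * (K : ℝ) * ‖q - p‖ := by fun_prop
    exact hc.continuousAt.eventually_lt_const (by simp)
  filter_upwards [hnear] with q hq hedge u v γ
  -- Here `m` is the displacement normalized to fix `v₀`. Equal edge lengths make its rows
  -- quadratically small, so `‖m‖ ≤ 2K‖m‖²`. Since `2K‖m‖ ≤ 4K‖q - p‖ < 1`, this forces `m = 0`.
  set m : V → Plane := (q - p) - translation V (q v₀ - p v₀) with hm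
  have hmapp : ∀ v, m v = q v - p v - (q v₀ - p v₀) := fun v => rfl
  have hm2 : ‖m‖ ≤ 2 * ‖q - p‖ := by
    refine (pi_norm_le_iff_of_nonneg (by positivity)).2 fun v => ?_
    have h1 : ‖(q - p) v‖ ≤ ‖q - p‖ := norm_le_pi_norm _ _
    have h2 : ‖(q - p) v₀‖ ≤ ‖q - p‖ := norm_le_pi_norm _ _
    calc ‖m v‖ ≤ ‖(q - p) v‖ + ‖(q - p) v₀‖ := norm_sub_le _ _
      _ ≤ 2 * ‖q - p‖ := by linarith
  have hrow : ∀ e, |G.row L p e m| ≤ 2 * ‖m‖ ^ 2 := by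
    intro e
    have h1 := hedge e
    set a := p (G.src e) - (p (G.tgt e) + L (G.label e)) with ha
    set d := m (G.src e) - m (G.tgt e) with hd
    have h2 : q (G.src e) - (q (G.tgt e) + L (G.label e)) = a + d := by
      rw [hd, hmapp, hmapp, ha]; abel
    rw [h2, norm_add_sq_real] at h1
    have h3 : G.row L p e m = inner ℝ a d := rfl
    have h4 : ‖d‖ ≤ 2 * ‖m‖ := by
      have h5 := norm_le_pi_norm m (G.src e)
      have h6 := norm_le_pi_norm m (G.tgt e)
      have h7 := norm_sub_le (m (G.src e)) (m (G.tgt e))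
      linarith
    have h8 : ‖d‖ ^ 2 ≤ (2 * ‖m‖) ^ 2 := by gcongr
    have h9 : 0 ≤ ‖d‖ ^ 2 := by positivity
    rw [h3, abs_le]
    constructor <;> nlinarith
  have hRm : ‖R m‖ ≤ 2 * ‖m‖ ^ 2 := by
    refine (Prod.norm_def _).trans_le (max_le ?_ ?_)
    · exact (pi_norm_le_iff_of_nonneg (by positivity)).2 fun e => hrow e
    · have : (R m).2 = 0 := by
        change m v₀ = 0
        rw [hmapp, sub_self]
      rw [this, norm_zero]
      positivity
  have hm0 : m = 0 := by
    by_contra hne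
    have hpos : 0 < ‖m‖ := norm_pos_iff.2 hne
    have h1 := hbound m
    have hK' : (0 : ℝ) < K := hK
    have h2 : ‖m‖ ≤ K * (2 * ‖m‖ ^ 2) := h1.trans (by gcongr)
    have h3 : 2 * (K : ℝ) * ‖m‖ < 1 := by nlinarith
    nlinarith
  have h1 := congrFun hm0 u
  have h2 := congrFun hm0 v
  rw [hmapp] at h1 h2
  have h3 : q u - (q v + L γ) = p u - (p v + L γ) := by
    rw [← sub_eq_zero]
    have : q u - (q v + L γ) - (p u - (p v + L γ)) =
        (q u - p u - (q v₀ - p v₀)) - (q v - p v - (q v₀ - p v₀)) := by abel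
    rw [this, h1, h2]
    simp
  rw [h3]

theorem hasDerivAt_norm_sq_edge [Finite V] {c : ℝ → V → Plane} {c' : V → Plane} {t : ℝ}
    (hc : HasDerivAt c c' t) (u v : V) (a : Plane) :
    HasDerivAt (fun s => ‖c s u - (c s v + a)‖ ^ 2)
      (2 * inner ℝ (c t u - (c t v + a)) (c' u - c' v)) t := by
  have := Fintype.ofFinite V
  have h1 := hasDerivAt_pi.1 hc
  exact ((h1 u).sub ((h1 v).add_const a)).norm_sq

/-- An infinitesimal motion of edges with independent rows is the velocity of a motion. -/
theorem exists_curve_in_fibre [Finite V] [Finite E] {G : LabeledGraph V E Γ} {L : Γ →+ Plane}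
    {p : V → Plane} {F : Set E} (hF : LinearIndepOn ℝ (G.row L p) F) {w : V → Plane}
    (hw : w ∈ G.motions L p F) :
    ∃ c : ℝ → V → Plane, c 0 = p ∧ HasDerivAt c w 0 ∧
      (∀ᶠ t in 𝓝 (0 : ℝ), DifferentiableAt ℝ c t) ∧
      ∀ᶠ t in 𝓝 (0 : ℝ), ∀ e ∈ F, ‖G.edgeVec L (c t) e‖ ^ 2 = ‖G.edgeVec L p e‖ ^ 2 := by
  classical
  have := Fintype.ofFinite V
  have := Fintype.ofFinite F
  let K := G.motions L p F
  obtain ⟨P, hP⟩ := LinearMap.exists_leftInverse_of_injective K.subtype K.ker_subtype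
  let R : (V → Plane) →ₗ[ℝ] (F → ℝ) := LinearMap.pi fun e => G.row L p e
  have hinj : Function.Injective (R.prod P) := by
    rw [← LinearMap.ker_eq_bot, LinearMap.ker_eq_bot']
    intro m hm
    have h1 : m ∈ K := fun e he => congrFun (congrArg Prod.fst hm) ⟨e, he⟩
    have h2 := LinearMap.congr_fun hP ⟨m, h1⟩
    have h3 : P m = 0 := congrArg Prod.snd hm
    have h4 : P m = ⟨m, h1⟩ := h2
    exact congrArg Subtype.val (h4.symm.trans h3)
  have hdim : Module.finrank ℝ (V → Plane) = Module.finrank ℝ ((F → ℝ) × K) := by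
    rw [finrank_framework, ← ncard_add_finrank_motions hF, Module.finrank_prod,
      Module.finrank_fintype_fun_eq_card, Set.ncard_eq_toFinset_card', Set.toFinset_card]
  let A : (V → Plane) ≃L[ℝ] (F → ℝ) × K :=
    (LinearEquiv.ofInjectiveOfFinrankEq (R.prod P) hinj hdim).toContinuousLinearEquiv
  have hA : ∀ m, A m = (R m, P m) := fun m => rfl
  let Pc : (V → Plane) →L[ℝ] K := P.toContinuousLinearMap
  -- Half the squared lengths on `F`, completed by a projection onto the motions of `F`, form a
  -- local diffeomorphism at `p`; the factor 1/2 makes the derivative of a length exactly its row.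
  -- The curve is the preimage of the line in direction `(0, w)`.
  let Φ : (V → Plane) → (F → ℝ) × K := fun q =>
    (fun e => (1 / 2 : ℝ) * ‖q (G.src e) - (q (G.tgt e) + L (G.label e))‖ ^ 2, Pc q)
  have hΦ : ContDiff ℝ 1 Φ := by
    refine ContDiff.prodMk (contDiff_pi.2 fun e => ?_) Pc.contDiff
    refine contDiff_const.mul (ContDiff.norm_sq ℝ ?_)
    fun_prop
  have hder : HasFDerivAt Φ (A : (V → Plane) →L[ℝ] (F → ℝ) × K) p := by
    have h1 : DifferentiableAt ℝ Φ p := (hΦ.differentiable (by simp)).differentiableAt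
    convert! h1.hasFDerivAt using 1
    ext1 m
    have hline : HasDerivAt (fun t : ℝ => p + t • m) m 0 := by
      simpa using ((hasDerivAt_id (0 : ℝ)).smul_const m).const_add p
    have h2 : HasDerivAt (fun t : ℝ => Φ (p + t • m)) (fderiv ℝ Φ p m) 0 := by
      have h1' : HasFDerivAt Φ (fderiv ℝ Φ p) (p + (0 : ℝ) • m) := by
        simpa using h1.hasFDerivAt
      exact h1'.comp_hasDerivAt (0 : ℝ) hline
    have h3 : HasDerivAt (fun t : ℝ => Φ (p + t • m)) (A m) 0 := by
      rw [hA]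
      refine HasDerivAt.prodMk (hasDerivAt_pi.2 fun e => ?_) ?_
      · have := (hasDerivAt_norm_sq_edge hline (G.src e) (G.tgt e) (L (G.label e))).const_mul
          (1 / 2 : ℝ)
        convert! this using 1
        rw [← mul_assoc]
        simp [R, row_apply, edgeVec]
      · exact Pc.hasFDerivAt.comp_hasDerivAt (0 : ℝ) hline
    exact h3.unique h2
  have hs : HasStrictFDerivAt Φ (A : (V → Plane) →L[ℝ] (F → ℝ) × K) p :=
    hΦ.contDiffAt.hasStrictFDerivAt' hder (by simp)
  let g := hs.localInverse Φ A p
  have hgcd : ContDiffAt ℝ 1 g (Φ p) := hΦ.contDiffAt.to_localInverse hder (by simp)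
  have hgp : g (Φ p) = p := hs.localInverse_apply_image
  let ℓ : ℝ → (F → ℝ) × K := fun t => Φ p + t • (0, ⟨w, hw⟩)
  have hℓ0 : ℓ 0 = Φ p := by simp [ℓ]
  have hℓ : ContDiff ℝ 1 ℓ := by
    simp only [ℓ]
    fun_prop
  have hℓd : HasDerivAt ℓ (0, ⟨w, hw⟩) 0 := by
    have h1 := ((hasDerivAt_id' (0 : ℝ)).smul_const
      ((0, ⟨w, hw⟩) : (F → ℝ) × K)).const_add (Φ p)
    rwa [one_smul] at h1
  have hccd : ContDiffAt ℝ 1 (fun t => g (ℓ t)) 0 := by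
    refine ContDiffAt.comp (0 : ℝ) ?_ hℓ.contDiffAt
    rwa [hℓ0]
  refine ⟨fun t => g (ℓ t), ?_, ?_, ?_, ?_⟩
  · simp only [hℓ0, hgp]
  · have h1 : HasFDerivAt g (A.symm : (F → ℝ) × K →L[ℝ] (V → Plane)) (ℓ 0) := by
      rw [hℓ0]
      exact hs.to_localInverse.hasFDerivAt
    have h2 := h1.comp_hasDerivAt (0 : ℝ) hℓd
    convert! h2 using 1
    symm
    change A.symm (0, ⟨w, hw⟩) = w
    rw [ContinuousLinearEquiv.symm_apply_eq, hA]
    refine Prod.ext ?_ ?_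
    · ext e
      exact (hw e e.2).symm
    · exact (LinearMap.congr_fun hP ⟨w, hw⟩).symm
  · filter_upwards [hccd.eventually (by simp)] with t ht
    exact ht.differentiableAt (by simp)
  · have h1 : ∀ᶠ t in 𝓝 (0 : ℝ), Φ (g (ℓ t)) = ℓ t := by
      have h2 := hs.eventually_right_inverse
      rw [← hℓ0] at h2
      exact hℓ.continuous.continuousAt.eventually h2
    filter_upwards [h1] with t ht e he
    have h2 := congrFun (congrArg Prod.fst ht) ⟨e, he⟩
    simp only [Φ, ℓ, Prod.fst_add, Prod.smul_fst, smul_zero, add_zero] at h2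
    simp only [edgeVec]
    linarith

/-- For generic frameworks rigidity implies infinitesimal rigidity. -/
theorem Generic.motions_le_of_lPeriodicallyRigid [Finite V] [Finite E] {G : LabeledGraph V E Γ}
    {L : Γ →+ Plane} {p : V → Plane} (hp : Generic L p) {γ : Γ} (hγ : L γ ≠ 0)
    (h : G.LPeriodicallyRigid L p) :
    G.motions L p Set.univ ≤ agreeOn (translation V) Set.univ := by
  have := Fintype.ofFinite V
  intro w hw
  -- A basis of the rows at `p`; only the lengths of these edges are prescribed along the curve.
  obtain ⟨F, -, -, hspan, hF⟩ := exists_linearIndepOn_extension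
    (linearIndepOn_empty ℝ (G.row L p)) (Set.empty_subset (Set.univ : Set E))
  obtain ⟨c, hc0, hcw, hcd, hcF⟩ := exists_curve_in_fibre hF (motions_anti (Set.subset_univ F) hw)
  have hctend : Tendsto c (𝓝 0) (𝓝 p) := by
    have := hcw.continuousAt.tendsto
    rwa [hc0] at this
  have hcI := hctend.eventually (eventually_linearIndepOn_row hF)
  obtain ⟨ε, hε, hball⟩ := Metric.eventually_nhds_iff_ball.1 (hcd.and (hcF.and hcI))
  have hconst : ∀ t ∈ Metric.ball (0 : ℝ) ε, ∀ e,
      ‖G.edgeVec L (c t) e‖ ^ 2 = ‖G.edgeVec L (c 0) e‖ ^ 2 := by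
    intro t ht e
    have hd : ∀ s ∈ Metric.ball (0 : ℝ) ε, ∀ e, HasDerivAt (fun t => ‖G.edgeVec L (c t) e‖ ^ 2)
        (2 * G.row L (c s) e (deriv c s)) s := fun s hs e =>
      hasDerivAt_norm_sq_edge (hball s hs).1.hasDerivAt _ _ _
    have hzero : ∀ s ∈ Metric.ball (0 : ℝ) ε, ∀ e, G.row L (c s) e (deriv c s) = 0 := by
      intro s hs e
      obtain ⟨-, -, hI⟩ := hball s hs
      have hmot : deriv c s ∈ G.motions L (c s) F := by
        intro f hf
        have h1 : HasDerivAt (fun t => ‖G.edgeVec L (c t) f‖ ^ 2) 0 s := by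
          refine (hasDerivAt_const s (‖G.edgeVec L p f‖ ^ 2)).congr_of_eventuallyEq ?_
          filter_upwards [Metric.isOpen_ball.mem_nhds hs] with r hr
          exact (hball r hr).2.1 f hf
        have h2 := (hd s hs f).unique h1
        linarith
      -- Rows independent at `c s` are independent at the generic `p`. So no row leaves the span of
      -- the rows of `F` along the curve, and all edge lengths stay constant.
      refine row_eq_zero_of_mem_span ?_ hmot
      rw [hI.mem_span_iff]
      intro hins
      have := hp.linearIndepOn_row hins
      exact (hF.mem_span_iff.1 (hspan ⟨e, trivial, rfl⟩)) this
    exact Metric.isOpen_ball.is_const_of_deriv_eq_zero (convex_ball (0 : ℝ) ε).isPreconnected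
      (f := fun t => ‖G.edgeVec L (c t) e‖ ^ 2)
      (fun s hs => (hd s hs e).differentiableAt.differentiableWithinAt)
      (fun s hs => by rw [(hd s hs e).deriv, hzero s hs e]; simp) ht (Metric.mem_ball_self hε)
  have hall : ∀ᶠ t in 𝓝 (0 : ℝ), ∀ u v γ,
      ‖p u - (p v + L γ)‖ ^ 2 = ‖c t u - (c t v + L γ)‖ ^ 2 := by
    filter_upwards [hctend.eventually h, Metric.ball_mem_nhds (0 : ℝ) hε] with t ht htε
    refine ht fun e => ?_
    have := hconst t htε e
    rw [hc0] at this
    exact this.symm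
  have hinner : ∀ u v γ, inner ℝ (p u - (p v + L γ)) (w u - w v) = (0 : ℝ) := by
    intro u v γ
    have h1 := hasDerivAt_norm_sq_edge hcw u v (L γ)
    have h2 : HasDerivAt (fun t => ‖c t u - (c t v + L γ)‖ ^ 2) 0 0 := by
      refine (hasDerivAt_const (0 : ℝ) (‖p u - (p v + L γ)‖ ^ 2)).congr_of_eventuallyEq ?_
      filter_upwards [hall] with t ht
      exact (ht u v γ).symm
    have h3 := h1.unique h2
    rw [hc0] at h3
    linarith
  -- Labels 0 and `γ` make `w u - w v` orthogonal to `p u - p v` and to `L γ`, which are independent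
  -- by genericity.
  have heq : ∀ u v, w u = w v := by
    intro u v
    by_cases huv : u = v
    · rw [huv]
    have h1 := hinner u v 0
    have h2 := hinner u v γ
    have h3 := hp.cross_ne_zero huv hγ
    rw [inner_plane] at h1 h2
    simp only [map_zero, add_zero, PiLp.sub_apply, PiLp.add_apply] at h1 h2
    have h4 : L γ 0 * (w u 0 - w v 0) + L γ 1 * (w u 1 - w v 1) = 0 := by linarith
    have h5 : w u 0 - w v 0 = 0 := by
      refine (mul_eq_zero.1 ?_).resolve_left h3
      linear_combination L γ 1 * h1 - (p u 1 - p v 1) * h4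
    have h6 : w u 1 - w v 1 = 0 := by
      refine (mul_eq_zero.1 ?_).resolve_left h3
      linear_combination (p u 0 - p v 0) * h4 - L γ 0 * h1
    ext i
    fin_cases i
    · exact sub_eq_zero.1 h5
    · exact sub_eq_zero.1 h6
  rcases isEmpty_or_nonempty V with hV | ⟨⟨v₀⟩⟩
  · exact ⟨0, fun v => hV.elim v⟩
  · exact ⟨w v₀, fun v _ => heq v v₀⟩

/-! ### Edge deletion and the two implications -/

theorem motions_deleteEdge (G : LabeledGraph V E Γ) (L : Γ →+ Plane) (p : V → Plane) (e : E) :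
    (G.deleteEdge e).motions L p Set.univ = G.motions L p {e}ᶜ := by
  ext m
  exact ⟨fun h f hf => h ⟨f, hf⟩ trivial, fun h f _ => h f.1 f.2⟩

theorem exists_map_ne_zero {G : LabeledGraph V E Γ} (hunb : ¬ G.Balanced Set.univ)
    {L : Γ →+ Plane} (hL : Function.Injective L) : ∃ γ, L γ ≠ 0 := by
  unfold Balanced at hunb
  push Not at hunb
  obtain ⟨v, γ, -, hγ⟩ := hunb
  exact ⟨γ, fun h => hγ ((map_eq_zero_iff L hL).1 h)⟩

theorem exists_nonsingular_generic [Finite V] [Module.Free ℤ Γ] [Module.Finite ℤ Γ]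
    (hk : Module.finrank ℤ Γ ≤ 2) :
    ∃ (L : Γ →+ Plane) (p : V → Plane), Nonsingular L ∧ Generic L p := by
  have : Countable Γ := (Module.finBasis ℤ Γ).equivFun.injective.countable
  obtain ⟨L, hL⟩ := exists_nonsingular hk
  obtain ⟨p, hp⟩ := exists_generic (V := V) L
  exact ⟨L, p, hL, hp⟩

/-- In the "some" form `L'` and `p'` may vary with the deleted edge. This is harmless: each serves
only to find a circuit through that edge, and the count matroid does not depend on them. -/
theorem mConnected_of_redundantlyPeriodicallyRigid [Finite V] [Finite E] [Module.Free ℤ Γ]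
    [Module.Finite ℤ Γ] (hk : Module.finrank ℤ Γ ≤ 2)
    {G : LabeledGraph V E Γ} (hiso : ∀ v, ∃ e, G.src e = v ∨ G.tgt e = v)
    (hunb : ¬ G.Balanced Set.univ) (hblock : ¬ ∃ H : G.Subgraph, H.IsBlock 0 2)
    (h₂ : G.TwoConnected) (hr : G.RedundantlyPeriodicallyRigid 2) : G.MConnected := by
  obtain ⟨L, p, hL, hp⟩ := exists_nonsingular_generic (V := V) hk
  refine mConnected_of_forall_exists_isCircuit hiso h₂.1.to_nonempty hblock
    (fun A hA hA' => h₂.two_le_ncard hA hA') (fun e => ?_) hL.injective hp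
  obtain ⟨L', p', hL', hp', hr'⟩ := hr e
  obtain ⟨γ, hγ⟩ := exists_map_ne_zero hunb hL'.injective
  have h := hp'.motions_le_of_lPeriodicallyRigid hγ hr'
  rw [motions_deleteEdge] at h
  exact exists_isCircuit_of_motions_le hL'.injective hp' h

theorem RedundantlyPeriodicallyRigidAny.some [Finite V] [Module.Free ℤ Γ]
    [Module.Finite ℤ Γ] (hk : Module.finrank ℤ Γ ≤ 2)
    {G : LabeledGraph V E Γ} (h : G.RedundantlyPeriodicallyRigidAny 2) :
    G.RedundantlyPeriodicallyRigid 2 := by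
  obtain ⟨L, p, hL, hp⟩ := exists_nonsingular_generic (V := V) hk
  exact fun e => ⟨L, p, hL, hp, h e L p hL hp⟩

theorem MConnected.redundantlyPeriodicallyRigidAny [Finite V] [Finite E] [Module.Free ℤ Γ]
    [Module.Finite ℤ Γ] {G : LabeledGraph V E Γ} (hG : G.MConnected)
    (hiso : ∀ v, ∃ e, G.src e = v ∨ G.tgt e = v) (hunb : ¬ G.Balanced Set.univ) :
    G.RedundantlyPeriodicallyRigidAny 2 := by
  intro e L p hL hp
  apply lPeriodicallyRigid_of_motions_le
  rw [motions_deleteEdge]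
  exact hG.motions_le hiso hunb hL.injective hp e

theorem MConnected.twoConnected [Finite V] [Finite E] {G : LabeledGraph V E Γ} (hG : G.MConnected)
    (hiso : ∀ v, ∃ e, G.src e = v ∨ G.tgt e = v) : G.TwoConnected := by
  obtain ⟨e, -⟩ := hG.1.nonempty
  exact twoConnected_of_two_le_ncard ⟨_, _, G.loopless e⟩ hiso fun A hA hA' =>
    hG.two_le_ncard hA hA'

end LabeledGraph

theorem theorem5p14 {V E Γ : Type*} [Finite V] [Finite E] [AddCommGroup Γ]
    [Module.Free ℤ Γ] [Module.Finite ℤ Γ] (hk : Module.finrank ℤ Γ ≤ 2)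
    (G : LabeledGraph V E Γ)
    (hiso : ∀ v, ∃ e, G.src e = v ∨ G.tgt e = v)
    (hunb : ¬ G.Balanced Set.univ)
    (hblock : ¬ ∃ H : G.Subgraph, H.IsBlock 0 2) :
    (G.TwoConnected ∧ G.RedundantlyPeriodicallyRigid 2 ↔ G.MConnected) ∧
    (G.TwoConnected ∧ G.RedundantlyPeriodicallyRigidAny 2 ↔ G.MConnected) := by
  have hsome : G.TwoConnected → G.RedundantlyPeriodicallyRigid 2 → G.MConnected :=
    LabeledGraph.mConnected_of_redundantlyPeriodicallyRigid hk hiso hunb hblock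
  have hany : G.MConnected → G.TwoConnected ∧ G.RedundantlyPeriodicallyRigidAny 2 := fun hG =>
    ⟨hG.twoConnected hiso, hG.redundantlyPeriodicallyRigidAny hiso hunb⟩
  exact ⟨⟨fun h => hsome h.1 h.2, fun hG => ⟨(hany hG).1, (hany hG).2.some hk⟩⟩,
    ⟨fun h => hsome h.1 (h.2.some hk), hany⟩⟩
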